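/- **Setting.** Let $m,n\in\mathbb N$, $0<\alpha<mn$, $0<\gamma\le 1$, and let $K_\alpha:\mathbb R^n\times(\mathbb R^n)^m\to\mathbb R$ be a measurable kernel such that, for some constants $A,c>0$, $$|K_\alpha(x,\vec y)|\le \frac{A}{(\sum_{i=1}^m|x-y_i|)^{mn-\alpha}}\quad\text{if }\sum_{i}|x-y_i|>0,$$ $$|K_\alpha(x,\vec y)-K_\alpha(x',\vec y)|\le \frac{A|x-x'|^\gamma}{(\sum_{i=1}^m|x-y_i|)^{mn-\alpha+\gamma}}\quad\text{if }\sum_{i}|x-y_i|>c|x-x'|.$$ Put $T\vec f(x)=\int_{(\mathbb R^n)^m}K_\alpha(x,\vec y)\prod_{i=1}^m f_i(y_i)\,d\vec y$. For a function $b$ and an operator $S$ on $m$-tuples $\vec f=(f_1,\dots,f_m)$ put $[b,S]_j\vec f=bS(\vec f)-S(f_1,\dots,bf_j,\dots,f_m)$, and for $\bm b=(b_1,\dots,b_m)$ let $$\mathcal T^m_{\alpha,\bm b}=[b_m,\dots[b_2,[b_1,T]_1]_2\dots]_m ,$$ which formally equals $\int F_x(\vec y)\,d\vec y$ with $F_x(\vec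 y)=K_\alpha(x,\vec y)\prod_{i=1}^m(b_i(x)-b_i(y_i))f_i(y_i)$. A weight is a locally integrable function that is positive and finite almost everywhere; $w^{-1}(B)=\int_B w^{-1}$; $g_B$ is the average of $g$ over $B$; $q'$ is the conjugate exponent of $q\in[1,\infty]$. A weight $u$ is in $\mathrm{RH}_s$, $1\le s<\infty$, if there is $C$ with $\left(\frac1{|B|}\int_B u^s\right)^{1/s}\le \frac{C}{|B|}\int_B u$ for all balls $B$ (no condition when $s=1$). $\Lambda(\delta)$ is the space of functions $b$ with $|b(x)-b(y)|\le C|x-y|^\delta$ for some $C$ and all $x,y$. For $\vec p\in[1,\infty]^m$ and real $\beta,\delta,\tilde\delta$, a pair $(w,\vec v)$ of a weight $w$ and a vector of weights $\vec v=(v_1,\dots,v_m)$ belongs to $\mathcal H_m(\vec p,\beta,\tilde\delta)$ if $w^{-1}(B)<\infty$ for all balls $B$ and there are numbers $0<\beta_i<n$ with $\sum_i\beta_i=\beta$ and a constant $C$ such that for every ball $B=B(x_B,R)$ $$\frac{|B|^{1+(\delta-\tilde\delta)/n}}{w^{-1}(B)}\prod_{i=1}^m\left\|\frac{v_i^{-1}}{(|B|^{1/n}+|x_B-\cdot|)^{n-\beta_i+\delta/m}}\right\|_{p_i'}\le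 C .$$ (The class also depends on $\delta$.) **Theorem.** Let $0<\delta<\min\{\gamma,(mn-\alpha)/m\}$, $\tilde\alpha=\alpha+m\delta$, and let $\vec p\in[1,\infty]^m$, $1/p=\sum_i1/p_i$, satisfy $p>n/\tilde\alpha$. Let $b_i\in\Lambda(\delta)$ for $1\le i\le m$, let $\tilde\delta\le\delta$, and let $(w,\vec v)\in\mathcal H_m(\vec p,\tilde\alpha,\tilde\delta)$ (with this $\delta$) be such that $v_i^{-p_i'}\in\mathrm{RH}_m$ for every $i$ with $1<p_i\le\infty$. Then $\mathcal T^m_{\alpha,\bm b}$ is bounded from $\prod_iL^{p_i}(v_i^{p_i})$ to $\mathcal L_w(\tilde\delta)$. That is, there is a constant $C>0$ such that for every $\vec f$ with $f_iv_i\in L^{p_i}$, $1\le i\le m$: 1. if, for almost every $x$, all the integrals $T(g_1,\dots,g_m)(x)$, $g_i\in\{f_i,b_if_i\}$, that enter the iterated commutator converge absolutely, then $g=\mathcal T^m_{\alpha,\bm b}\vec f$ is locally integrable and, for every ball $B$, $$\frac{1}{w^{-1}(B)|B|^{\tilde\delta/n}}\int_B|g(x)-g_B|\,dx\le C\prod_{i=1}^m\|f_iv_i\|_{p_i};\qquad(*)$$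 2. without any convergence assumption, $\mathcal T^m_{\alpha,\bm b}\vec f$ is well defined modulo additive constants and satisfies the same estimate: there is a locally integrable $g$ such that for almost every $x$ and almost every $z$ the function $F_x-F_z$ is integrable on $(\mathbb R^n)^m$ with $g(x)-g(z)=\int(F_x-F_z)\,d\vec y$, and $(*)$ holds for $g$ and every ball $B$. -/

import Mathlib

open MeasureTheory Set
open scoped ENNReal NNReal

noncomputable section

namespace FracComm

/-- Euclidean space `ℝⁿ`. -/
abbrev E (n : ℕ) : Type := EuclideanSpace ℝ (Fin n)

/-- A weight: a locally integrable function which is positive almost everywhere. -/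
def IsWeight {n : ℕ} (w : E n → ℝ) : Prop :=
  LocallyIntegrable w volume ∧ ∀ᵐ x, 0 < w x

/-- `w⁻¹(B) = ∫_B w⁻¹` for the ball `B = B(xB, R)`. -/
def invMass {n : ℕ} (w : E n → ℝ) (xB : E n) (R : ℝ) : ℝ≥0∞ :=
  ∫⁻ x in Metric.ball xB R, ENNReal.ofReal (w x)⁻¹

/-- The reverse Hölder class `RH_s`, `1 ≤ s < ∞` (for `s = 1` it consists of all weights). -/
def ReverseHolder {n : ℕ} (s : ℝ) (u : E n → ℝ) : Prop :=
  IsWeight u ∧ ∃ C : ℝ≥0, ∀ (xB : E n) (R : ℝ), 0 < R →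
    ((∫⁻ x in Metric.ball xB R, ENNReal.ofReal (u x) ^ s) / volume (Metric.ball xB R)) ^ (1 / s)
      ≤ C * ((∫⁻ x in Metric.ball xB R, ENNReal.ofReal (u x)) / volume (Metric.ball xB R))

/-- The class `H_m(p, β, δ')` of pairs `(w, v)`, which also depends on the real number `δ`.
The number `β` is split as `β = ∑ i, β_i` with `0 < β_i < n`, and `w⁻¹(B)`, by which
one divides, is finite for every ball `B`. The conjugate exponent `p_i'` is
`ENNReal.conjExponent (p i)`, with `1' = ∞` and `∞' = 1`. -/
def ClassH {n m : ℕ} (p : Fin m → ℝ≥0∞) (β δ δ' : ℝ)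
    (w : E n → ℝ) (v : Fin m → E n → ℝ) : Prop :=
  (∀ (xB : E n) (R : ℝ), 0 < R → invMass w xB R < ∞) ∧
  ∃ βs : Fin m → ℝ, (∀ i, 0 < βs i ∧ βs i < n) ∧ ∑ i, βs i = β ∧
    ∃ C : ℝ≥0, ∀ (xB : E n) (R : ℝ), 0 < R →
      volume (Metric.ball xB R) ^ (1 + (δ - δ') / n) / invMass w xB R *
        ∏ i, eLpNorm (fun x => (v i x)⁻¹ /
            (volume.real (Metric.ball xB R) ^ (1 / (n : ℝ)) + ‖xB - x‖)
              ^ (n - βs i + δ / m)) (p i).conjExponent volume ≤ C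

/-- The Lipschitz space `Λ(δ)`. -/
def IsLip {n : ℕ} (δ : ℝ) (b : E n → ℝ) : Prop :=
  ∃ L : ℝ, ∀ x y, |b x - b y| ≤ L * ‖x - y‖ ^ δ

/-- Size condition `|K(x,y)| ≲ (∑ i, |x - y_i|)^(-(mn - α))` off the diagonal. -/
def SizeCondition {n m : ℕ} (α : ℝ) (K : E n → (Fin m → E n) → ℝ) : Prop :=
  ∃ A : ℝ, ∀ x y, 0 < ∑ i, ‖x - y i‖ →
    |K x y| ≤ A / (∑ i, ‖x - y i‖) ^ ((m : ℝ) * n - α)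

/-- Smoothness condition of order `γ` in the first variable, whenever
`∑ i, |x - y_i| > c |x - x'|`, for some fixed constant `c > 0`. -/
def SmoothnessCondition {n m : ℕ} (α γ : ℝ) (K : E n → (Fin m → E n) → ℝ) : Prop :=
  ∃ c : ℝ, 0 < c ∧ ∃ A : ℝ, ∀ x x' y, c * ‖x - x'‖ < ∑ i, ‖x - y i‖ →
    |K x y - K x' y| ≤ A * ‖x - x'‖ ^ γ / (∑ i, ‖x - y i‖) ^ ((m : ℝ) * n - α + γ)

/-- The multilinear operator `T f(x) = ∫ K(x,y) ∏ i, f_i(y_i) dy`. -/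
def multOp {n m : ℕ} (K : E n → (Fin m → E n) → ℝ) (f : Fin m → E n → ℝ) (x : E n) : ℝ :=
  ∫ y : Fin m → E n, K x y * ∏ i, f i (y i)

/-- The integral defining `T f(x)` converges absolutely. -/
def ConvergesAt {n m : ℕ} (K : E n → (Fin m → E n) → ℝ) (f : Fin m → E n → ℝ)
    (x : E n) : Prop :=
  Integrable (fun y : Fin m → E n => K x y * ∏ i, f i (y i)) volume

/-- The commutator in the `j`-th entry,
`[b, T]_j f = b T(f) - T(f_1, …, b f_j, …, f_m)`. -/
def commAt {n m : ℕ} (b : E n → ℝ) (j : Fin m)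
    (T : (Fin m → E n → ℝ) → E n → ℝ) (f : Fin m → E n → ℝ) (x : E n) : ℝ :=
  b x * T f x - T (Function.update f j (fun y => b y * f j y)) x

/-- The iterated product commutator `[b_m, … [b_2, [b_1, T]_1]_2 … ]_m`. -/
def prodComm {n m : ℕ} (b : Fin m → E n → ℝ)
    (T : (Fin m → E n → ℝ) → E n → ℝ) : (Fin m → E n → ℝ) → E n → ℝ :=
  (List.finRange m).foldl (fun S j => commAt (b j) j S) T

/-- All the integrals `T(g_1, …, g_m)(x)`, `g_i ∈ {f_i, b_i f_i}`, which enter the iterated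
product commutator of `f` at `x` converge absolutely. -/
def CommConvergesAt {n m : ℕ} (K : E n → (Fin m → E n) → ℝ) (b f : Fin m → E n → ℝ)
    (x : E n) : Prop :=
  ∀ s : Finset (Fin m), ConvergesAt K (fun i y => if i ∈ s then b i y * f i y else f i y) x

/-- The integrand `K(x,y) ∏ i, (b_i(x) - b_i(y_i)) f_i(y_i)` of the product commutator. -/
def commIntegrand {n m : ℕ} (K : E n → (Fin m → E n) → ℝ) (b f : Fin m → E n → ℝ)
    (x : E n) (y : Fin m → E n) : ℝ :=
  K x y * ∏ i, (b i x - b i (y i)) * f i (y i)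

/-- The weighted mean oscillation
`(w⁻¹(B) |B|^(δ'/n))⁻¹ ∫_B |g - g_B|` over `B = B(xB, R)`; its supremum over all balls is
the seminorm of the space `L_w(δ')`. -/
def lipOsc {n : ℕ} (w : E n → ℝ) (δ' : ℝ) (g : E n → ℝ) (xB : E n) (R : ℝ) : ℝ≥0∞ :=
  (∫⁻ x in Metric.ball xB R, ‖g x - ⨍ z in Metric.ball xB R, g z‖ₑ) /
    (invMass w xB R * volume (Metric.ball xB R) ^ (δ' / n))

end FracComm

end

open FracComm

/-!
Write `F_x(y) = K(x, y) ∏ i, (b_i(x) - b_i(y_i)) f_i(y_i)`. Everything follows from one estimate: on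
a ball `B = B(xB, R)`, the integral of `|F_x - F_z|` over `y` is at most `h(x) + h(z) + M` for all
`x, z ∈ B`, where `2 ∫_B h + M |B|` is bounded by `R^(n + δ)` times the product of the norms
`‖f_i v_i‖_{p_i}` and of the norms in the class `ClassH`
(`exists_lintegral_commIntegrand_sub_le`). Such a bound on the differences of a function controls
its mean oscillation over `B` (`integrable_and_lintegral_sub_average_le`), and the defining
inequality of `ClassH` turns this into the seminorm of `L_w(δ')` (`lipOsc_le`).

For the estimate, let `κB` be a large dilate of `B`.

* If some `y_i` is outside `κB`, then `F_x(y) - F_z(y)` is a difference of kernels or a difference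
  of products of the `b_i(x) - b_i(y_i)`. Either gains `R^δ`, and what remains is at most a multiple
  of `∏ i, |f_i(y_i)| / (|B|^(1/n) + |xB - y_i|)^(n - β_i + δ/m)`
  (`exists_enorm_commIntegrand_sub_le`); Hölder's inequality in each variable gives `M`.
* If all `y_i` lie in `κB`, no cancellation is used. The factors `b_i(x) - b_i(y_i)` reduce the
  singularity of the kernel to the order `m n - (α + m δ)`, which is split into a product of
  singularities `|x - y_i|^(-λ_i)` (`enorm_commIntegrand_le`). So `h` is a product of `m` truncated
  fractional integrals, and Hölder's inequality reduces its integral to their `L^m` norms. By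
  Young's inequality (`lintegral_convolution_rpow_le`) these are bounded by norms of `f_i` over
  `κB` with exponents `r_i`, `1 / r_i = 1 / p_i + 1 / (m p_i')`. Hölder's inequality bounds such a
  norm by `‖f_i v_i‖_{p_i}` times the `L^{m p_i'}` norm of `v_i⁻¹` on `κB`, and the condition `RH_m`
  lowers the exponent `m p_i'` to `p_i'` (`exists_eLpNorm_inv_le_of_reverseHolder`). The condition
  `p > n / (α + m δ)` is what allows the `λ_i` to be chosen so that the kernels in Young's
  inequality are locally integrable (`exists_splitting_exponent`).

The commutator modulo constants is `g(x) = ∫ (F_x - F_{z₀})` for a generic point `z₀`; the estimate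
on the balls `B(0, k + 1)` shows that `F_x - F_z` is integrable for almost all `x` and `z`. Where the
defining integrals converge, the iterated commutator is `∫ F_x` (`prodComm_eq_integral`).
-/

namespace FracComm

/-! ### Integration of products -/

theorem lintegral_fin_prod_eq_prod {X : Type*} [MeasureSpace X]
    [SigmaFinite (volume : Measure X)] {m : ℕ} {φ : Fin m → X → ℝ≥0∞}
    (hφ : ∀ i, AEMeasurable (φ i) volume) :
    ∫⁻ y : Fin m → X, ∏ i, φ i (y i) = ∏ i, ∫⁻ x, φ i x := by
  induction m with
  | zero => simp [volume_pi]
  | succ m ih =>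
    have key := (volume_preserving_piFinSuccAbove (fun _ : Fin (m + 1) => X) 0).symm
    rw [← key.lintegral_comp_emb (MeasurableEquiv.measurableEmbedding _)]
    simp_rw [MeasurableEquiv.piFinSuccAbove_symm_apply, Fin.insertNthEquiv,
      Fin.prod_univ_succ, Equiv.coe_fn_mk, Fin.insertNth_zero, Fin.cons_zero, Fin.cons_succ]
    rw [← ih fun i => hφ i.succ]
    refine lintegral_prod_mul (μ := (volume : Measure X)) (ν := (volume : Measure (Fin m → X)))
      (f := φ 0) (g := fun y => ∏ i, φ i.succ (y i)) (hφ 0)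
      (Finset.aemeasurable_fun_prod _ fun i _ => ?_)
    exact (hφ i.succ).comp_quasiMeasurePreserving
      (Measure.quasiMeasurePreserving_eval (fun _ : Fin m => (volume : Measure X)) i)

theorem lintegral_prod_le_prod_rpow {X : Type*} [MeasurableSpace X] {μ : Measure X} {m : ℕ}
    (hm : 0 < m) {H : Fin m → X → ℝ≥0∞} (hH : ∀ i, AEMeasurable (H i) μ) :
    ∫⁻ x, ∏ i, H i x ∂μ ≤ ∏ i, (∫⁻ x, H i x ^ (m : ℝ) ∂μ) ^ (1 / m : ℝ) := by
  have hm' : (m : ℝ) ≠ 0 := by positivity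
  have h := ENNReal.lintegral_prod_norm_pow_le (μ := μ) Finset.univ
    (f := fun i x => H i x ^ (m : ℝ)) (p := fun _ => 1 / (m : ℝ))
    (fun i _ => (hH i).pow_const _) (by simp [hm']) (fun _ _ => by positivity)
  simp_rw [← ENNReal.rpow_mul, mul_one_div_cancel hm', ENNReal.rpow_one] at h
  exact h

/-! ### A convolution inequality -/

/-- Young's inequality `‖k^{1-τ} * η^{1/s+τ}‖_s ≤ ‖k^{1-τ}‖ ‖η^{1/s+τ}‖`, in the exponents
`1/(1-τ)` and `1/(1/s+τ)`, written in terms of the integrals of `k` and `η`. -/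
theorem lintegral_convolution_rpow_le {n : ℕ} {k η : E n → ℝ≥0∞} (hk : Measurable k)
    (hη : AEMeasurable η volume) {s τ : ℝ} (hs : 0 < s) (hτ : 0 ≤ τ) (hτs : τ ≤ 1 - 1 / s) :
    (∫⁻ x, (∫⁻ y, k (x - y) ^ (1 - τ) * η y ^ (1 / s + τ)) ^ s) ^ (1 / s)
      ≤ (∫⁻ x, k x) ^ (1 - τ) * (∫⁻ y, η y) ^ (1 / s + τ) := by
  have hs' : 0 < 1 / s := by positivity
  have hkx : ∀ x : E n, AEMeasurable (fun y => k (x - y)) volume := fun x =>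
    (hk.comp (measurable_const.sub measurable_id)).aemeasurable
  have hint : ∀ x : E n, ∫⁻ y, k (x - y) = ∫⁻ y, k y := fun x =>
    lintegral_sub_left_eq_self k x
  set a := ∫⁻ x, k x
  set c := ∫⁻ y, η y
  have hpt : ∀ x : E n, (∫⁻ y, k (x - y) ^ (1 - τ) * η y ^ (1 / s + τ)) ≤
      (∫⁻ y, k (x - y) * η y) ^ (1 / s) * (a ^ (1 - 1 / s - τ) * c ^ τ) := by
    intro x
    have h := ENNReal.lintegral_prod_norm_pow_le (μ := (volume : Measure (E n))) Finset.univ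
      (f := ![fun y => k (x - y) * η y, fun y => k (x - y), η])
      (p := ![1 / s, 1 - 1 / s - τ, τ])
      (by intro i _; fin_cases i
          · exact (hkx x).mul hη
          · exact hkx x
          · exact hη)
      (by simp [Fin.sum_univ_three]; ring)
      (by intro i _; fin_cases i
          · exact hs'.le
          · show 0 ≤ 1 - 1 / s - τ
            linarith
          · exact hτ)
    simp only [Fin.prod_univ_three, Matrix.cons_val_zero, Matrix.cons_val_one,
      Matrix.cons_val_two, Matrix.head_cons, Matrix.tail_cons] at h
    rw [hint x] at h
    calc _ = _ := lintegral_congr fun y => ?_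
      _ ≤ _ := h
      _ = _ := by ring
    rw [ENNReal.mul_rpow_of_nonneg _ _ hs'.le, ENNReal.rpow_add_of_nonneg _ _ hs'.le hτ,
      show 1 - τ = 1 / s + (1 - 1 / s - τ) by ring,
      ENNReal.rpow_add_of_nonneg _ _ hs'.le (by linarith)]
    ring
  have hτ1 : 0 ≤ 1 - 1 / s - τ := by linarith
  have hfub : ∫⁻ x, ∫⁻ y, k (x - y) * η y = a * c := by
    rw [lintegral_lintegral_swap]
    · have : ∀ y : E n, ∫⁻ x, k (x - y) * η y = a * η y := fun y => by
        rw [lintegral_mul_const _ (by fun_prop : Measurable fun x => k (x - y)),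
          lintegral_sub_right_eq_self k y]
      simp_rw [this]
      rw [lintegral_const_mul'' _ hη]
    · exact (hk.comp (measurable_fst.sub measurable_snd)).aemeasurable.mul
        (hη.comp_quasiMeasurePreserving Measure.quasiMeasurePreserving_snd)
  have hmeas : AEMeasurable (fun x : E n => ∫⁻ y, k (x - y) * η y) volume :=
    AEMeasurable.lintegral_prod_right' (f := fun z : E n × E n => k (z.1 - z.2) * η z.2)
      ((hk.comp (measurable_fst.sub measurable_snd)).aemeasurable.mul
        (hη.comp_quasiMeasurePreserving Measure.quasiMeasurePreserving_snd))
  calc (∫⁻ x, (∫⁻ y, k (x - y) ^ (1 - τ) * η y ^ (1 / s + τ)) ^ s) ^ (1 / s)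
      ≤ (∫⁻ x, (∫⁻ y, k (x - y) * η y) * (a ^ (1 - 1 / s - τ) * c ^ τ) ^ s) ^ (1 / s) := by
        gcongr with x
        refine (ENNReal.rpow_le_rpow (hpt x) hs.le).trans_eq ?_
        rw [ENNReal.mul_rpow_of_nonneg _ _ hs.le, ← ENNReal.rpow_mul,
          one_div_mul_cancel hs.ne', ENNReal.rpow_one]
    _ = (a * c) ^ (1 / s) * (a ^ (1 - 1 / s - τ) * c ^ τ) := by
        rw [lintegral_mul_const'' _ hmeas, hfub, ENNReal.mul_rpow_of_nonneg _ _ hs'.le,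
          ← ENNReal.rpow_mul, mul_one_div_cancel hs.ne', ENNReal.rpow_one]
    _ = a ^ (1 - τ) * c ^ (1 / s + τ) := by
        rw [ENNReal.mul_rpow_of_nonneg _ _ hs'.le, ENNReal.rpow_add_of_nonneg _ _ hs'.le hτ,
          show 1 - τ = 1 / s + (1 - 1 / s - τ) by ring,
          ENNReal.rpow_add_of_nonneg _ _ hs'.le hτ1]
        ring

/-! ### Truncated Riesz kernels -/

/-- The kernel `|u|^{-a}` of a fractional integral, cut off to the ball `B(0, ρ)`. -/
noncomputable def truncKernel {n : ℕ} (a ρ : ℝ) : E n → ℝ≥0∞ :=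
  (Metric.ball 0 ρ).indicator fun u => ‖u‖ₑ ^ (-a)

theorem measurable_truncKernel {n : ℕ} (a ρ : ℝ) : Measurable (truncKernel (n := n) a ρ) :=
  (measurable_enorm.pow_const _).indicator Metric.isOpen_ball.measurableSet

theorem truncKernel_of_mem {n : ℕ} {a ρ : ℝ} {u : E n} (h : ‖u‖ < ρ) :
    truncKernel a ρ u = ‖u‖ₑ ^ (-a) :=
  indicator_of_mem (by simpa using h) _

theorem lintegral_truncKernel_one_lt_top {n : ℕ} (hn : 0 < n) {a : ℝ} (ha : a < n) :
    ∫⁻ u : E n, truncKernel a 1 u < ∞ := by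
  have : Nonempty (Fin n) := ⟨⟨0, hn⟩⟩
  have hI : IntegrableOn (fun u : E n => ‖u‖ ^ (-a)) (Metric.ball 0 1) volume := by
    rw [integrableOn_fun_norm_addHaar volume (f := fun t : ℝ => t ^ (-a)),
      finrank_euclideanSpace_fin]
    have h := (intervalIntegral.integrableOn_Ioo_rpow_iff (s := (n : ℝ) - 1 - a) one_pos).2
      (by linarith)
    refine h.congr_fun (fun t ht => ?_) measurableSet_Ioo
    have ht0 : 0 < t := ht.1
    simp only [smul_eq_mul]
    rw [← Real.rpow_natCast, ← Real.rpow_add ht0, Nat.cast_sub hn, Nat.cast_one, ← sub_eq_add_neg]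
  have h2 := hI.2
  rw [hasFiniteIntegral_iff_enorm] at h2
  refine lt_of_eq_of_lt ?_ h2
  rw [truncKernel, lintegral_indicator Metric.isOpen_ball.measurableSet]
  refine lintegral_congr_ae ?_
  have h0 : ∀ᵐ u : E n ∂(volume.restrict (Metric.ball 0 1)), u ≠ 0 :=
    ae_restrict_of_ae (Measure.ae_ne volume 0)
  filter_upwards [h0] with u hu
  rw [← ofReal_norm, ENNReal.ofReal_rpow_of_pos (norm_pos_iff.2 hu), ← ofReal_norm,
    Real.norm_of_nonneg (by positivity)]

theorem lintegral_truncKernel {n : ℕ} (a : ℝ) {ρ : ℝ} (hρ : 0 < ρ) :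
    ∫⁻ u : E n, truncKernel a ρ u
      = ENNReal.ofReal (ρ ^ (n - a)) * ∫⁻ u : E n, truncKernel a 1 u := by
  have h1 : ∀ u : E n, truncKernel a ρ (ρ • u) = ENNReal.ofReal (ρ ^ (-a)) * truncKernel a 1 u := by
    intro u
    by_cases hu : ‖u‖ < 1
    · rw [truncKernel_of_mem hu, truncKernel_of_mem, enorm_smul, ENNReal.mul_rpow_of_ne_top,
        Real.enorm_of_nonneg hρ.le, ENNReal.ofReal_rpow_of_pos hρ]
      · exact enorm_ne_top
      · exact enorm_ne_top
      · rw [norm_smul, Real.norm_of_nonneg hρ.le]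
        nlinarith
    · rw [truncKernel, truncKernel, indicator_of_notMem, indicator_of_notMem, mul_zero]
      · simpa using hu
      · simp only [Metric.mem_ball, dist_zero_right, norm_smul, Real.norm_of_nonneg hρ.le, not_lt]
        nlinarith
  have h2 := Measure.map_addHaar_smul (volume : Measure (E n)) hρ.ne'
  have h3 : ∫⁻ u : E n, truncKernel a ρ (ρ • u)
      = ENNReal.ofReal |(ρ ^ n)⁻¹| * ∫⁻ u : E n, truncKernel a ρ u := by
    rw [← lintegral_map (measurable_truncKernel a ρ) (measurable_const_smul ρ), h2,
      lintegral_smul_measure, finrank_euclideanSpace_fin, smul_eq_mul]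
  simp_rw [h1] at h3
  rw [lintegral_const_mul _ (measurable_truncKernel a 1)] at h3
  have h4 : ENNReal.ofReal (ρ ^ n) * ENNReal.ofReal |(ρ ^ n)⁻¹| = 1 := by
    rw [← ENNReal.ofReal_mul (by positivity), abs_of_pos (by positivity),
      mul_inv_cancel₀ (by positivity), ENNReal.ofReal_one]
  calc ∫⁻ u : E n, truncKernel a ρ u
      = ENNReal.ofReal (ρ ^ n) *
        (ENNReal.ofReal |(ρ ^ n)⁻¹| * ∫⁻ u : E n, truncKernel a ρ u) := by
        rw [← mul_assoc, h4, one_mul]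
    _ = _ := by
        rw [← h3, ← mul_assoc, ← ENNReal.ofReal_mul (by positivity), sub_eq_add_neg,
          Real.rpow_add hρ, Real.rpow_natCast]

/-! ### Mean oscillation from differences -/

/-- A function whose differences `g x - g z` are dominated by `h x + h z + M`, with `h` integrable,
is itself integrable, and its mean oscillation is controlled. -/
theorem integrable_and_lintegral_sub_average_le {X : Type*} [MeasurableSpace X] {μ : Measure X}
    [IsFiniteMeasure μ] [NeZero μ] {g : X → ℝ} (hg : AEStronglyMeasurable g μ) {h : X → ℝ≥0∞}
    (hh : AEMeasurable h μ) (hint : ∫⁻ x, h x ∂μ ≠ ∞) {M : ℝ≥0∞} (hM : M ≠ ∞)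
    (H : ∀ᵐ x ∂μ, ∀ᵐ z ∂μ, ‖g x - g z‖ₑ ≤ h x + h z + M) :
    Integrable g μ ∧
      ∫⁻ x, ‖g x - ⨍ z, g z ∂μ‖ₑ ∂μ ≤ 2 * ∫⁻ x, h x ∂μ + M * μ univ := by
  have hI : Integrable g μ := by
    obtain ⟨x₀, hx₀, hx₀'⟩ := (H.and (ae_lt_top' hh hint)).exists
    refine ⟨hg, ?_⟩
    rw [hasFiniteIntegral_iff_enorm]
    calc ∫⁻ z, ‖g z‖ₑ ∂μ ≤ ∫⁻ z, ((‖g x₀‖ₑ + h x₀ + M) + h z) ∂μ := by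
          refine lintegral_mono_ae ?_
          filter_upwards [hx₀] with z hz
          calc ‖g z‖ₑ = ‖g x₀ - (g x₀ - g z)‖ₑ := by rw [sub_sub_cancel]
            _ ≤ ‖g x₀‖ₑ + ‖g x₀ - g z‖ₑ := enorm_sub_le
            _ ≤ ‖g x₀‖ₑ + (h x₀ + h z + M) := by gcongr
            _ = _ := by ring
      _ = (‖g x₀‖ₑ + h x₀ + M) * μ univ + ∫⁻ z, h z ∂μ := by
          rw [lintegral_add_left measurable_const, lintegral_const]
      _ < ∞ := by finiteness
  refine ⟨hI, ?_⟩
  have hV0 : μ univ ≠ 0 := by simp [NeZero.ne]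
  have hV : μ univ ≠ ∞ := measure_ne_top _ _
  have hpt : ∀ x, ‖g x - ⨍ z, g z ∂μ‖ₑ ≤ (μ univ)⁻¹ * ∫⁻ z, ‖g x - g z‖ₑ ∂μ := by
    intro x
    have h1 : g x - ⨍ z, g z ∂μ = ⨍ z, (g x - g z) ∂μ := by
      have : ⨍ _z, g x ∂μ = g x := average_const μ (g x)
      rw [average_eq] at this ⊢
      rw [average_eq, integral_sub (integrable_const _) hI, smul_sub, this]
    rw [h1, average_eq, enorm_smul]
    gcongr
    · rw [measureReal_def, ← ENNReal.toReal_inv, Real.enorm_of_nonneg ENNReal.toReal_nonneg,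
        ENNReal.ofReal_toReal (by simpa using hV0)]
    · exact enorm_integral_le_lintegral_enorm _
  calc ∫⁻ x, ‖g x - ⨍ z, g z ∂μ‖ₑ ∂μ
      ≤ ∫⁻ x, (μ univ)⁻¹ * ∫⁻ z, (h x + h z + M) ∂μ ∂μ := by
        refine lintegral_mono_ae ?_
        filter_upwards [H] with x hx
        refine (hpt x).trans ?_
        gcongr 1
        exact lintegral_mono_ae hx
    _ = ∫⁻ x, (h x + (M + (μ univ)⁻¹ * ∫⁻ z, h z ∂μ)) ∂μ := by
        refine lintegral_congr fun x => ?_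
        have : ∫⁻ z, (h x + h z + M) ∂μ = (h x + M) * μ univ + ∫⁻ z, h z ∂μ := by
          rw [← lintegral_const, ← lintegral_add_left measurable_const]
          exact lintegral_congr fun z => by ring
        rw [this, mul_add, mul_left_comm, ENNReal.inv_mul_cancel hV0 hV, mul_one, add_assoc]
    _ = 2 * ∫⁻ x, h x ∂μ + M * μ univ := by
        rw [lintegral_add_right _ measurable_const, lintegral_const, add_mul, mul_right_comm,
          ENNReal.inv_mul_cancel hV0 hV]
        ring

/-! ### Expansion of the iterated commutator -/

theorem foldl_commAt_eq_integral {n m : ℕ} (K : E n → (Fin m → E n) → ℝ) (b : Fin m → E n → ℝ)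
    (x : E n) (l : List (Fin m)) (hl : l.Nodup) (f : Fin m → E n → ℝ)
    (hf : ∀ s : Finset (Fin m), (∀ i ∈ s, i ∈ l) →
      ConvergesAt K (fun i y => if i ∈ s then b i y * f i y else f i y) x) :
    Integrable (fun y => K x y * ((l.map fun i => b i x - b i (y i)).prod * ∏ i, f i (y i))) ∧
    l.foldl (fun S j => commAt (b j) j S) (multOp K) f x
      = ∫ y, K x y * ((l.map fun i => b i x - b i (y i)).prod * ∏ i, f i (y i)) := by
  induction l using List.reverseRecOn generalizing f with
  | nil =>
    have := hf ∅ (by simp)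
    simp only [ConvergesAt, Finset.notMem_empty, if_false] at this
    simpa [multOp] using this
  | append_singleton l j ih =>
    have hj : j ∉ l := fun h => by
      simpa [h] using (List.nodup_append.1 hl).2.2 j h j (by simp)
    have hl' : l.Nodup := (List.nodup_append.1 hl).1
    obtain ⟨h1, e1⟩ := ih hl' f fun s hs => hf s fun i hi => by simp [hs i hi]
    obtain ⟨h2, e2⟩ := ih hl' (Function.update f j fun y => b j y * f j y) fun s hs => by
      have hjs : j ∉ s := fun h => hj (hs j h)
      have := hf (insert j s) fun i hi => by
        rcases Finset.mem_insert.1 hi with rfl | hi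
        · simp
        · simp [hs i hi]
      convert this using 3 with i y
      by_cases hij : i = j
      · subst hij; simp [hjs]
      · simp [hij]
    have hprod : ∀ y : Fin m → E n,
        ∏ i, Function.update f j (fun y => b j y * f j y) i (y i)
          = b j (y j) * ∏ i, f i (y i) := by
      intro y
      rw [Fintype.prod_eq_mul_prod_compl j, Fintype.prod_eq_mul_prod_compl j (fun i => f i (y i)),
        Function.update_self, mul_assoc]
      congr 2
      refine Finset.prod_congr rfl fun i hi => ?_
      rw [Function.update_of_ne (by simpa using hi)]
    simp_rw [hprod] at h2 e2
    have hpt : ∀ y : Fin m → E n,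
        K x y * (((l ++ [j]).map fun i => b i x - b i (y i)).prod * ∏ i, f i (y i))
          = b j x * (K x y * ((l.map fun i => b i x - b i (y i)).prod * ∏ i, f i (y i)))
            - K x y * ((l.map fun i => b i x - b i (y i)).prod
              * (b j (y j) * ∏ i, f i (y i))) := by
      intro y
      simp only [List.map_append, List.prod_append, List.map_cons, List.map_nil, List.prod_cons,
        List.prod_nil]
      ring
    simp_rw [hpt]
    refine ⟨(h1.const_mul _).sub h2, ?_⟩
    rw [integral_sub (h1.const_mul _) h2, integral_const_mul, ← e1, ← e2, List.foldl_append]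
    rfl

/-- Where the defining integrals converge, the iterated commutator is the integral of
`commIntegrand`. -/
theorem prodComm_eq_integral {n m : ℕ} {K : E n → (Fin m → E n) → ℝ} {b f : Fin m → E n → ℝ}
    {x : E n} (h : CommConvergesAt K b f x) :
    Integrable (commIntegrand K b f x) ∧
      prodComm b (multOp K) f x = ∫ y, commIntegrand K b f x y := by
  have := foldl_commAt_eq_integral K b x (List.finRange m) (List.nodup_finRange m) f
    fun s _ => h s
  have e : ∀ y : Fin m → E n,
      K x y * (((List.finRange m).map fun i => b i x - b i (y i)).prod * ∏ i, f i (y i))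
        = commIntegrand K b f x y := fun y => by
    rw [commIntegrand, Finset.prod_mul_distrib, ← List.ofFn_eq_map, List.prod_ofFn]
  simp_rw [e] at this
  exact this

/-! ### Pointwise bounds for the commutator integrand -/

theorem abs_prod_le_pow_card {ι : Type*} (s : Finset ι) {a : ι → ℝ} {W : ℝ}
    (ha : ∀ i ∈ s, |a i| ≤ W) : |∏ i ∈ s, a i| ≤ W ^ s.card := by
  rw [Finset.abs_prod, ← Finset.prod_const]
  exact Finset.prod_le_prod (fun i _ => abs_nonneg _) ha

theorem abs_prod_sub_prod_mul_le {ι : Type*} (s : Finset ι) {a c : ι → ℝ} {W η : ℝ} (hW : 0 ≤ W)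
    (hη : 0 ≤ η) (ha : ∀ i ∈ s, |a i| ≤ W) (hc : ∀ i ∈ s, |c i| ≤ W)
    (hac : ∀ i ∈ s, |a i - c i| ≤ η) :
    |∏ i ∈ s, a i - ∏ i ∈ s, c i| * W ≤ s.card * η * W ^ s.card := by
  classical
  induction s using Finset.induction_on with
  | empty => simp
  | insert j s hj ih =>
    have ih := ih (fun i hi => ha i (by simp [hi])) (fun i hi => hc i (by simp [hi]))
      fun i hi => hac i (by simp [hi])
    have hp : |∏ i ∈ s, c i| ≤ W ^ s.card :=
      abs_prod_le_pow_card s fun i hi => hc i (by simp [hi])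
    rw [Finset.prod_insert hj, Finset.prod_insert hj, Finset.card_insert_of_notMem hj]
    have e : a j * ∏ i ∈ s, a i - c j * ∏ i ∈ s, c i
        = a j * (∏ i ∈ s, a i - ∏ i ∈ s, c i) + (a j - c j) * ∏ i ∈ s, c i := by ring
    calc |a j * ∏ i ∈ s, a i - c j * ∏ i ∈ s, c i| * W
        ≤ (|a j| * |∏ i ∈ s, a i - ∏ i ∈ s, c i| + |a j - c j| * |∏ i ∈ s, c i|) * W := by
          rw [e, ← abs_mul, ← abs_mul]
          gcongr
          exact abs_add_le _ _
      _ = |a j| * (|∏ i ∈ s, a i - ∏ i ∈ s, c i| * W) + |a j - c j| * |∏ i ∈ s, c i| * W := by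
          ring
      _ ≤ W * (s.card * η * W ^ s.card) + η * W ^ s.card * W := by
          gcongr
          · exact ha j (by simp)
          · exact hac j (by simp)
      _ = _ := by push_cast; ring

section Pointwise

variable {n m : ℕ} {α γ δ A L : ℝ} {K : E n → (Fin m → E n) → ℝ} {b : Fin m → E n → ℝ}

theorem commIntegrand_eq (f : Fin m → E n → ℝ) (x : E n) (y : Fin m → E n) :
    commIntegrand K b f x y = (K x y * ∏ i, (b i x - b i (y i))) * ∏ i, f i (y i) := by
  rw [commIntegrand, Finset.prod_mul_distrib, mul_assoc]

/-- The differences of the `b i` cancel part of the singularity of the kernel. -/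
theorem enorm_commIntegrand_le (hm : 0 < m) (hA : 0 ≤ A) (hL : 0 ≤ L) (hδ : 0 < δ)
    (hsize : ∀ x y, 0 < ∑ i, ‖x - y i‖ → |K x y| ≤ A / (∑ i, ‖x - y i‖) ^ ((m : ℝ) * n - α))
    (hb : ∀ i x y, |b i x - b i y| ≤ L * ‖x - y‖ ^ δ) {lam : Fin m → ℝ} (hlam : ∀ i, 0 ≤ lam i)
    (hsum : ∑ i, lam i = m * n - (α + m * δ)) (f : Fin m → E n → ℝ) (x : E n)
    (y : Fin m → E n) :
    ‖commIntegrand K b f x y‖ₑ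
      ≤ ENNReal.ofReal (A * L ^ m) * ∏ i, (‖x - y i‖ₑ ^ (-lam i) * ‖f i (y i)‖ₑ) := by
  set S := ∑ i, ‖x - y i‖ with hS
  have hle : ∀ i, ‖x - y i‖ ≤ S := fun i =>
    Finset.single_le_sum (f := fun i => ‖x - y i‖) (fun i _ => norm_nonneg _) (Finset.mem_univ i)
  have hS0 : 0 ≤ S := (norm_nonneg _).trans (hle ⟨0, hm⟩)
  rw [commIntegrand_eq, enorm_mul, Finset.prod_mul_distrib, ← mul_assoc]
  have hf : ‖∏ i, f i (y i)‖ₑ = ∏ i, ‖f i (y i)‖ₑ := by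
    simp only [← ofReal_norm, norm_prod]
    exact ENNReal.ofReal_prod_of_nonneg fun i _ => norm_nonneg _
  rw [hf]
  gcongr
  rcases hS0.eq_or_lt with h0 | hpos
  · have : ∏ i, (b i x - b i (y i)) = 0 := by
      refine Finset.prod_eq_zero (Finset.mem_univ ⟨0, hm⟩) ?_
      have h1 := hb ⟨0, hm⟩ x (y ⟨0, hm⟩)
      have h2 : ‖x - y ⟨0, hm⟩‖ = 0 := le_antisymm ((hle _).trans h0.symm.le) (norm_nonneg _)
      rw [h2, Real.zero_rpow hδ.ne', mul_zero] at h1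
      exact abs_nonpos_iff.1 h1
    simp [this]
  · have h1 : |K x y * ∏ i, (b i x - b i (y i))| ≤ A * L ^ m * ∏ i, S ^ (-lam i) := by
      rw [← Real.rpow_sum_of_pos hpos, Finset.sum_neg_distrib, hsum, abs_mul]
      have h2 : |∏ i, (b i x - b i (y i))| ≤ (L * S ^ δ) ^ m := by
        simpa using abs_prod_le_pow_card Finset.univ (a := fun i => b i x - b i (y i))
          fun i _ => (hb i x (y i)).trans
            (mul_le_mul_of_nonneg_left (Real.rpow_le_rpow (norm_nonneg _) (hle i) hδ.le) hL)
      calc |K x y| * |∏ i, (b i x - b i (y i))|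
          ≤ A / S ^ ((m : ℝ) * n - α) * (L * S ^ δ) ^ m := by
            gcongr
            exact hsize x y hpos
        _ = A * L ^ m * (S ^ (-((m : ℝ) * n - α)) * S ^ (δ * m)) := by
            rw [Real.rpow_neg hpos.le, mul_pow, Real.rpow_mul_natCast hpos.le]
            ring
        _ = _ := by
            rw [← Real.rpow_add hpos]
            congr 2
            ring
    rw [← ofReal_norm, Real.norm_eq_abs]
    refine (ENNReal.ofReal_le_ofReal h1).trans ?_
    rw [ENNReal.ofReal_mul (by positivity),
      ENNReal.ofReal_prod_of_nonneg fun i _ => by positivity]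
    gcongr with i
    rw [← ENNReal.ofReal_rpow_of_pos hpos]
    rw [ENNReal.rpow_neg, ENNReal.rpow_neg, ENNReal.inv_le_inv]
    refine ENNReal.rpow_le_rpow ?_ (hlam i)
    rw [← ofReal_norm]
    exact ENNReal.ofReal_le_ofReal (hle i)

theorem enorm_le_of_abs_le {ι : Type*} [Fintype ι] {r c : ℝ} {a : ι → ℝ}
    (h : |r| ≤ c * ∏ i, |a i|) :
    ‖r‖ₑ ≤ ENNReal.ofReal c * ∏ i, ‖a i‖ₑ := by
  simp_rw [← ofReal_norm, Real.norm_eq_abs]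
  rw [← ENNReal.ofReal_prod_of_nonneg fun i _ => abs_nonneg _,
    ← ENNReal.ofReal_mul' (Finset.prod_nonneg fun i _ => abs_nonneg _)]
  exact ENNReal.ofReal_le_ofReal h

theorem abs_mul_prod_sub_mul_prod_le {ι : Type*} [Fintype ι] {Kx Kz A₁ A₂ R T N : ℝ}
    {a c : ι → ℝ} (hA₁ : 0 ≤ A₁) (hA₂ : 0 ≤ A₂) (hL : 0 < L) (hR : 0 < R) (hRT : R ≤ T)
    (hδγ : δ ≤ γ) (hK : |Kx - Kz| ≤ A₁ * R ^ γ / T ^ (N + γ)) (hKz : |Kz| ≤ A₂ / T ^ N)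
    (ha : ∀ i, |a i| ≤ L * T ^ δ) (hc : ∀ i, |c i| ≤ L * T ^ δ)
    (hac : ∀ i, |a i - c i| ≤ L * R ^ δ) :
    |Kx * ∏ i, a i - Kz * ∏ i, c i| ≤ (A₁ + Fintype.card ι * A₂) * L ^ Fintype.card ι * R ^ δ
      * T ^ (-(N - Fintype.card ι * δ + δ)) := by
  set m := Fintype.card ι
  have hT : 0 < T := hR.trans_le hRT
  have h1 : |∏ i, a i| ≤ (L * T ^ δ) ^ m := abs_prod_le_pow_card Finset.univ fun i _ => ha i
  have h2 : |∏ i, a i - ∏ i, c i| ≤ m * (L * R ^ δ) * (L * T ^ δ) ^ m / (L * T ^ δ) := by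
    rw [le_div_iff₀ (by positivity)]
    exact abs_prod_sub_prod_mul_le Finset.univ (by positivity) (by positivity) (fun i _ => ha i)
      (fun i _ => hc i) fun i _ => hac i
  have h3 : R ^ γ ≤ R ^ δ * T ^ (γ - δ) := by
    calc R ^ γ = R ^ δ * R ^ (γ - δ) := by rw [← Real.rpow_add hR]; ring_nf
      _ ≤ _ := by gcongr
  have e1 : (L * T ^ δ) ^ m = L ^ m * T ^ (δ * m) := by
    rw [mul_pow, Real.rpow_mul_natCast hT.le]
  calc |Kx * ∏ i, a i - Kz * ∏ i, c i|
      = |(Kx - Kz) * ∏ i, a i + Kz * (∏ i, a i - ∏ i, c i)| := by congr 1; ring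
    _ ≤ |Kx - Kz| * |∏ i, a i| + |Kz| * |∏ i, a i - ∏ i, c i| := by
        rw [← abs_mul, ← abs_mul]; exact abs_add_le _ _
    _ ≤ A₁ * (R ^ δ * T ^ (γ - δ)) / T ^ (N + γ) * (L * T ^ δ) ^ m
        + A₂ / T ^ N * (m * (L * R ^ δ) * (L * T ^ δ) ^ m / (L * T ^ δ)) := by
        gcongr
        exact hK.trans (by gcongr)
    _ = A₁ * L ^ m * R ^ δ * (T ^ (γ - δ) * T ^ (-(N + γ)) * T ^ (δ * m))
        + m * A₂ * L ^ m * R ^ δ * (T ^ (-N) * T ^ (δ * m) * T ^ (-δ)) := by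
        rw [e1, Real.rpow_neg hT.le, Real.rpow_neg hT.le, Real.rpow_neg hT.le]
        field_simp
    _ = _ := by
        simp only [← Real.rpow_add hT]
        rw [show γ - δ + -(N + γ) + δ * m = -(N - m * δ + δ) by ring,
          show -N + δ * m + -δ = -(N - m * δ + δ) by ring]
        ring

theorem inv_rpow_le_of_le_mul {k S T s : ℝ} (hk : 0 < k) (hS : 0 < S) (hT : 0 < T) (hs : 0 ≤ s)
    (h : T ≤ k * S) : (S ^ s)⁻¹ ≤ k ^ s / T ^ s := by
  have hSs : 0 < S ^ s := Real.rpow_pos_of_pos hS s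
  have hTs : 0 < T ^ s := Real.rpow_pos_of_pos hT s
  rw [inv_le_iff_one_le_mul₀ hSs, div_mul_eq_mul_div, one_le_div hTs, ← Real.mul_rpow hk.le hS.le]
  exact Real.rpow_le_rpow hT.le h hs

/-- If some `y i` lies outside a large dilate of `B(xB, R)`, then the distances of the `y i` from
any point `u` of the ball are governed by `R + ∑ i, |xB - y i|`. -/
theorem sum_norm_sub_comparable {c R : ℝ} (hc : 0 < c) (hR : 0 < R) {xB u : E n}
    (hu : u ∈ Metric.ball xB R) {y : Fin m → E n} {j : Fin m}
    (hj : y j ∉ Metric.ball xB ((2 * c + 2) * R)) :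
    c * (2 * R) < ∑ i, ‖u - y i‖ ∧
      R + ∑ i, ‖xB - y i‖ ≤ (m + 2) * ∑ i, ‖u - y i‖ ∧
      ∀ i, ‖u - y i‖ ≤ R + ∑ i, ‖xB - y i‖ := by
  have hj' : (2 * c + 2) * R ≤ ‖xB - y j‖ := by
    rw [norm_sub_rev, ← dist_eq_norm]
    simpa using hj
  have hu' : ‖u - xB‖ < R := by rwa [← dist_eq_norm]
  have h1 : ∀ i, ‖xB - y i‖ ≤ ‖u - y i‖ + R := fun i => by
    have := norm_sub_le (u - y i) (u - xB)
    rw [sub_sub_sub_cancel_left] at this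
    linarith
  have h2 : ‖u - y j‖ ≤ ∑ i, ‖u - y i‖ :=
    Finset.single_le_sum (f := fun i => ‖u - y i‖) (fun i _ => norm_nonneg _) (Finset.mem_univ j)
  have h3 : (2 * c + 1) * R ≤ ∑ i, ‖u - y i‖ := by linarith [h1 j]
  have h4 : ∑ i, ‖xB - y i‖ ≤ (∑ i, ‖u - y i‖) + m * R := by
    refine (Finset.sum_le_sum fun i _ => h1 i).trans_eq ?_
    rw [Finset.sum_add_distrib]; simp
  have h5 : R ≤ ∑ i, ‖u - y i‖ := by
    have := mul_pos hc hR
    linarith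
  refine ⟨by linarith, ?_, fun i => ?_⟩
  · have : m * R ≤ m * ∑ i, ‖u - y i‖ := by gcongr
    linarith
  · have h6 := norm_add_le (u - xB) (xB - y i)
    rw [sub_add_sub_cancel] at h6
    have h7 : ‖xB - y i‖ ≤ ∑ i, ‖xB - y i‖ :=
      Finset.single_le_sum (f := fun i => ‖xB - y i‖) (fun i _ => norm_nonneg _)
        (Finset.mem_univ i)
    linarith

theorem rpow_neg_le_prod_inv_rpow {q ρ₀ R s : ℝ} (hq : 1 ≤ q) (hρq : ρ₀ ≤ q) (hρ₀ : 0 < ρ₀)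
    (hR : 0 < R) {d e : Fin m → ℝ} (hd : ∀ i, 0 ≤ d i) (he : ∀ i, 0 ≤ e i) (hsum : ∑ i, e i = s) :
    (R + ∑ i, d i) ^ (-s) ≤ q ^ s * ∏ i, ((ρ₀ * R + d i) ^ e i)⁻¹ := by
  have hsum0 : 0 ≤ ∑ i, d i := Finset.sum_nonneg fun i _ => hd i
  have hT0 : 0 < R + ∑ i, d i := by linarith
  have hq0 : 0 < q := by linarith
  have hDi : ∀ i, 0 < ρ₀ * R + d i := fun i => add_pos_of_pos_of_nonneg (mul_pos hρ₀ hR) (hd i)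
  rw [Real.rpow_neg hT0.le, Finset.prod_inv_distrib, ← div_eq_mul_inv,
    le_div_iff₀ (Finset.prod_pos fun i _ => Real.rpow_pos_of_pos (hDi i) _),
    inv_mul_le_iff₀ (Real.rpow_pos_of_pos hT0 _), ← Real.mul_rpow hT0.le hq0.le, ← hsum,
    Real.rpow_sum_of_pos (mul_pos hT0 hq0)]
  refine Finset.prod_le_prod (fun i _ => (Real.rpow_pos_of_pos (hDi i) _).le) fun i _ => ?_
  refine Real.rpow_le_rpow (hDi i).le ?_ (he i)
  have h1 : ρ₀ * R ≤ q * R := mul_le_mul_of_nonneg_right hρq hR.le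
  have h2 : d i ≤ q * ∑ i, d i :=
    (Finset.single_le_sum (fun i _ => hd i) (Finset.mem_univ i)).trans
      (le_mul_of_one_le_left hsum0 hq)
  linarith

/-- Off the `m`-fold product of a dilated ball, the smoothness of the kernel makes the difference
of two commutator integrands small. -/
theorem exists_enorm_commIntegrand_sub_le (hδ : 0 < δ) (hδγ : δ ≤ γ)
    (hα' : α < (m : ℝ) * n)
    (hsize : ∀ x y, 0 < ∑ i, ‖x - y i‖ → |K x y| ≤ A / (∑ i, ‖x - y i‖) ^ ((m : ℝ) * n - α))
    (hsmooth : SmoothnessCondition α γ K) (hA : 0 ≤ A) (hL : 0 < L)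
    (hb : ∀ i x y, |b i x - b i y| ≤ L * ‖x - y‖ ^ δ) {ρ₀ : ℝ} (hρ₀ : 0 < ρ₀) {e : Fin m → ℝ}
    (he : ∀ i, 0 ≤ e i) (hsum : ∑ i, e i = m * n - α - m * δ + δ) :
    ∃ C : ℝ, 0 ≤ C ∧ ∃ κ : ℝ, 1 ≤ κ ∧ ∀ (f : Fin m → E n → ℝ) (xB : E n) (R : ℝ), 0 < R →
      ∀ x ∈ Metric.ball xB R, ∀ z ∈ Metric.ball xB R, ∀ y : Fin m → E n,
      (∃ i, y i ∉ Metric.ball xB (κ * R)) →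
      ‖commIntegrand K b f x y - commIntegrand K b f z y‖ₑ
        ≤ ENNReal.ofReal (C * R ^ δ) * ∏ i, ‖f i (y i) / (ρ₀ * R + ‖xB - y i‖) ^ e i‖ₑ := by
  obtain ⟨c, hc, A', hA'⟩ := hsmooth
  obtain ⟨N, hN⟩ : ∃ N : ℝ, N = m * n - α := ⟨_, rfl⟩
  obtain ⟨k, hk⟩ : ∃ k : ℝ, k = m + 2 := ⟨_, rfl⟩
  obtain ⟨q, hq⟩ : ∃ q : ℝ, q = max ρ₀ 1 := ⟨_, rfl⟩
  simp only [← hN] at hsize hA' hsum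
  have hN0 : 0 < N := by linarith
  have hk2 : 2 ≤ k := by rw [hk]; linarith [(Nat.cast_nonneg m : (0 : ℝ) ≤ m)]
  have hk0 : 0 < k := by linarith
  have hq1 : 1 ≤ q := hq ▸ le_max_right _ _
  have hq0 : 0 < q := by linarith
  have hγ : 0 < γ := hδ.trans_le hδγ
  refine ⟨((|A'| * 2 ^ γ * k ^ (N + γ)) + m * (A * k ^ N)) * (L * k ^ δ) ^ m
    * q ^ (N - m * δ + δ), by positivity, 2 * c + 2, by linarith,
    fun f xB R hR x hx z hz y ⟨j, hj⟩ => ?_⟩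
  obtain ⟨hx1, hx2, hx3⟩ := sum_norm_sub_comparable hc hR hx hj
  obtain ⟨hz1, hz2, hz3⟩ := sum_norm_sub_comparable hc hR hz hj
  rw [← hk] at hx2 hz2
  have hD := rpow_neg_le_prod_inv_rpow hq1 (hq ▸ le_max_left _ _) hρ₀ hR
    (fun i => norm_nonneg (xB - y i)) he hsum
  have hsum0 : 0 ≤ ∑ i, ‖xB - y i‖ := Finset.sum_nonneg fun i _ => norm_nonneg _
  obtain ⟨T, hT⟩ : ∃ T : ℝ, T = R + ∑ i, ‖xB - y i‖ := ⟨_, rfl⟩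
  rw [← hT] at hD hx2 hz2
  simp only [← hT] at hx3 hz3
  have hRT : R ≤ T := by linarith
  have hT0 : 0 < T := by linarith
  have hxz : ‖x - z‖ ≤ 2 * R := by
    rw [← dist_eq_norm]
    have := dist_triangle_right x z xB
    rw [Metric.mem_ball] at hx hz
    linarith
  have hcR : 0 < c * (2 * R) := by positivity
  have hSz0 : 0 < ∑ i, ‖z - y i‖ := hcR.trans hz1
  have hSx0 : 0 < ∑ i, ‖x - y i‖ := hcR.trans hx1
  have hbk : ∀ {r r' : ℝ}, 0 ≤ r → r ≤ k * r' → 0 ≤ r' → L * r ^ δ ≤ L * k ^ δ * r' ^ δ := by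
    intro r r' hr h hr'
    rw [mul_assoc, ← Real.mul_rpow hk0.le hr']
    exact mul_le_mul_of_nonneg_left (Real.rpow_le_rpow hr h hδ.le) hL.le
  have hTk : T ≤ k * T := le_mul_of_one_le_left hT0.le (by linarith)
  have key := abs_mul_prod_sub_mul_prod_le (ι := Fin m) (Kx := K x y) (Kz := K z y)
    (A₁ := |A'| * 2 ^ γ * k ^ (N + γ)) (A₂ := A * k ^ N) (R := R) (T := T) (N := N) (δ := δ)
    (γ := γ) (L := L * k ^ δ) (a := fun i => b i x - b i (y i)) (c := fun i => b i z - b i (y i))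
    (by positivity) (by positivity) (by positivity) hR hRT hδγ ?_ ?_ ?_ ?_ ?_
  · rw [Fintype.card_fin] at key
    refine enorm_le_of_abs_le ?_
    rw [commIntegrand_eq, commIntegrand_eq, ← sub_mul, abs_mul, Finset.abs_prod]
    have hsplit : ∏ i, |f i (y i) / (ρ₀ * R + ‖xB - y i‖) ^ e i|
        = (∏ i, ((ρ₀ * R + ‖xB - y i‖) ^ e i)⁻¹) * ∏ i, |f i (y i)| := by
      rw [← Finset.prod_mul_distrib]
      refine Finset.prod_congr rfl fun i _ => ?_
      rw [abs_div, abs_of_nonneg (by positivity : 0 ≤ (ρ₀ * R + ‖xB - y i‖) ^ e i), div_eq_inv_mul]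
    rw [hsplit, ← mul_assoc]
    refine mul_le_mul_of_nonneg_right ((key.trans (mul_le_mul_of_nonneg_left hD
      (by positivity))).trans_eq ?_) (Finset.prod_nonneg fun i _ => abs_nonneg _)
    ring
  · refine (hA' x z y (lt_of_le_of_lt (mul_le_mul_of_nonneg_left hxz hc.le) hx1)).trans ?_
    calc A' * ‖x - z‖ ^ γ / (∑ i, ‖x - y i‖) ^ (N + γ)
        ≤ |A'| * (2 * R) ^ γ * ((∑ i, ‖x - y i‖) ^ (N + γ))⁻¹ := by
          rw [div_eq_mul_inv]
          gcongr
          exact le_abs_self _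
      _ ≤ |A'| * (2 * R) ^ γ * (k ^ (N + γ) / T ^ (N + γ)) := by
          gcongr
          exact inv_rpow_le_of_le_mul hk0 hSx0 hT0 (by linarith) hx2
      _ = _ := by rw [Real.mul_rpow (by norm_num) hR.le]; ring
  · refine (hsize z y hSz0).trans ?_
    rw [div_eq_mul_inv, mul_div_assoc]
    exact mul_le_mul_of_nonneg_left (inv_rpow_le_of_le_mul hk0 hSz0 hT0 hN0.le hz2) hA
  · exact fun i => (hb i x (y i)).trans
      (hbk (norm_nonneg _) ((hx3 i).trans hTk) hT0.le)
  · exact fun i => (hb i z (y i)).trans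
      (hbk (norm_nonneg _) ((hz3 i).trans hTk) hT0.le)
  · intro i
    rw [sub_sub_sub_cancel_right]
    exact (hb i x z).trans
      (hbk (norm_nonneg _) (hxz.trans (mul_le_mul_of_nonneg_right hk2 hR.le)) hR.le)

end Pointwise

/-! ### Weighted norms on balls -/

theorem exists_volume_ball_eq (n : ℕ) : ∃ ω : ℝ, 0 < ω ∧ ∀ (x : E n) (R : ℝ), 0 < R →
    volume (Metric.ball x R) = ENNReal.ofReal (ω * R ^ n) := by
  refine ⟨volume.real (Metric.ball (0 : E n) 1), ?_, fun x R hR => ?_⟩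
  · exact ENNReal.toReal_pos (Metric.measure_ball_pos _ _ one_pos).ne' measure_ball_lt_top.ne
  · rw [Measure.addHaar_ball_of_pos _ _ hR, finrank_euclideanSpace_fin, mul_comm,
      ENNReal.ofReal_mul measureReal_nonneg, ofReal_measureReal]

/-- The norm `‖v⁻¹ / (ρ₀ R + |xB - ·|)^e‖_{p'}` which occurs in the class `ClassH`, where `ρ₀ R` is
the `n`-th root of the volume of `B(xB, R)`. -/
noncomputable def tailNorm {n : ℕ} (ρ₀ e : ℝ) (p : ℝ≥0∞) (v : E n → ℝ) (xB : E n) (R : ℝ) : ℝ≥0∞ :=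
  eLpNorm (fun x => (v x)⁻¹ / (ρ₀ * R + ‖xB - x‖) ^ e) p.conjExponent volume

section OneWeight

variable {n : ℕ} {v : E n → ℝ} {p : ℝ≥0∞}

theorem IsWeight.aestronglyMeasurable (hv : IsWeight v) : AEStronglyMeasurable v volume :=
  hv.1.aestronglyMeasurable

theorem IsWeight.aemeasurable_of_mul (hv : IsWeight v) {f : E n → ℝ}
    (hf : AEStronglyMeasurable (fun x => f x * v x) volume) : AEMeasurable f volume := by
  refine (hf.aemeasurable.div hv.aestronglyMeasurable.aemeasurable).congr ?_
  filter_upwards [hv.2] with x hx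
  simp only [Pi.div_apply]
  field_simp

theorem conjExponent_inv (hp : 1 ≤ p) :
    p.conjExponent⁻¹ = ENNReal.ofReal (1 - (p⁻¹).toReal) := by
  have := ENNReal.HolderConjugate.conjExponent hp
  have h1 : p⁻¹ ≤ 1 := ENNReal.inv_le_one.2 hp
  rw [← ENNReal.HolderConjugate.one_sub_inv p p.conjExponent,
    ENNReal.ofReal_sub _ ENNReal.toReal_nonneg, ENNReal.ofReal_one,
    ENNReal.ofReal_toReal (h1.trans_lt ENNReal.one_lt_top).ne]

theorem toReal_inv_mem_Icc (hp : 1 ≤ p) : (p⁻¹).toReal ∈ Icc (0 : ℝ) 1 := by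
  refine ⟨ENNReal.toReal_nonneg, ?_⟩
  have := ENNReal.toReal_mono ENNReal.one_ne_top (ENNReal.inv_le_one.2 hp)
  simpa using this

/-- The reverse Hölder condition raises the integrability of `v⁻¹` on balls from `p'` to `m p'`.
For `p = 1` both exponents are infinite. -/
theorem exists_eLpNorm_inv_le_of_reverseHolder {m : ℕ} (hm : 0 < m) (hp : 1 ≤ p)
    (hv : IsWeight v)
    (hRH : 1 < p → ReverseHolder m (fun x => v x ^ (-p.conjExponent.toReal))) :
    ∃ C : ℝ≥0, ∀ (x : E n) (R : ℝ), 0 < R →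
      eLpNorm (fun y => (v y)⁻¹) (m * p.conjExponent) (volume.restrict (Metric.ball x R))
        ≤ C * ENNReal.ofReal (R ^ (n * ((1 / m - 1) * (1 - (p⁻¹).toReal)))) *
          eLpNorm (fun y => (v y)⁻¹) p.conjExponent (volume.restrict (Metric.ball x R)) := by
  have hm0 : (m : ℝ≥0∞) ≠ 0 := by exact_mod_cast hm.ne'
  rcases hp.eq_or_lt with rfl | hp1
  · refine ⟨1, fun x R hR => ?_⟩
    have : ENNReal.conjExponent 1 = ∞ := by simp [ENNReal.conjExponent]
    simp [this, ENNReal.mul_top hm0]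
  obtain ⟨-, C, hC⟩ := hRH hp1
  obtain ⟨ω, hω, hvol⟩ := exists_volume_ball_eq n
  set q := p.conjExponent with hq
  have hqinv : q⁻¹ = ENNReal.ofReal (1 - (p⁻¹).toReal) := conjExponent_inv hp
  have hπ := toReal_inv_mem_Icc hp
  have hπ1 : (p⁻¹).toReal < 1 := by
    have h := (ENNReal.toReal_lt_toReal (ENNReal.inv_ne_top.2 (by positivity))
      ENNReal.one_ne_top).2 (ENNReal.inv_lt_one.2 hp1)
    simpa using h
  have hq0 : q ≠ 0 := by
    rw [← ENNReal.inv_ne_top, hqinv]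
    exact ENNReal.ofReal_ne_top
  have hqt : q ≠ ∞ := by
    rw [← ENNReal.inv_ne_zero, hqinv, ENNReal.ofReal_ne_zero_iff]
    linarith
  have hqr : 1 / q.toReal = 1 - (p⁻¹).toReal := by
    rw [one_div, ← ENNReal.toReal_inv, hqinv, ENNReal.toReal_ofReal (by linarith)]
  have hqpos : 0 < q.toReal := ENNReal.toReal_pos hq0 hqt
  have hmR : (0 : ℝ) < m := by exact_mod_cast hm
  refine ⟨C ^ (1 / q.toReal) * Real.toNNReal ((ω ^ (1 / m - 1 : ℝ)) ^ (1 / q.toReal)),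
    fun x R hR => ?_⟩
  rw [eLpNorm_eq_lintegral_rpow_enorm_toReal hq0 hqt, eLpNorm_eq_lintegral_rpow_enorm_toReal
    (mul_ne_zero hm0 hq0) (ENNReal.mul_ne_top (by simp) hqt), ENNReal.toReal_mul,
    ENNReal.toReal_natCast]
  have hU : ∀ᵐ y ∂(volume.restrict (Metric.ball x R)),
      ‖(v y)⁻¹‖ₑ ^ q.toReal = ENNReal.ofReal (v y ^ (-q.toReal)) := by
    filter_upwards [ae_restrict_of_ae hv.2] with y hy
    rw [Real.enorm_of_nonneg (by positivity), ENNReal.ofReal_rpow_of_pos (by positivity),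
      Real.inv_rpow hy.le, Real.rpow_neg hy.le]
  have e1 : ∫⁻ y in Metric.ball x R, ‖(v y)⁻¹‖ₑ ^ ((m : ℝ) * q.toReal)
      = ∫⁻ y in Metric.ball x R, ENNReal.ofReal (v y ^ (-q.toReal)) ^ (m : ℝ) := by
    refine lintegral_congr_ae ?_
    filter_upwards [hU] with y hy
    rw [mul_comm, ENNReal.rpow_mul, hy]
  rw [e1, lintegral_congr_ae hU]
  have h := hC x R hR
  set I₁ := ∫⁻ y in Metric.ball x R, ENNReal.ofReal (v y ^ (-q.toReal)) ^ (m : ℝ)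
  set I₂ := ∫⁻ y in Metric.ball x R, ENNReal.ofReal (v y ^ (-q.toReal))
  have hVpos : 0 < ω * R ^ n := by positivity
  rw [hvol x R hR] at h
  set V := ENNReal.ofReal (ω * R ^ n) with hV
  have hV0 : V ≠ 0 := by simpa [hV] using hVpos
  have hVt : V ≠ ∞ := ENNReal.ofReal_ne_top
  have hmi : 0 ≤ 1 / (m : ℝ) := by positivity
  have h2 : I₁ ^ (1 / (m : ℝ)) ≤ C * V ^ (1 / m - 1 : ℝ) * I₂ := by
    rw [ENNReal.div_rpow_of_nonneg _ _ hmi, ENNReal.div_le_iff (by simp [hV0, hVt])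
      (by simp [hV0, hVt])] at h
    refine h.trans_eq ?_
    rw [ENNReal.rpow_sub _ _ hV0 hVt, ENNReal.rpow_one]
    simp only [div_eq_mul_inv]
    ring
  have hqi : 0 ≤ 1 / q.toReal := by positivity
  calc I₁ ^ (1 / ((m : ℝ) * q.toReal)) = (I₁ ^ (1 / (m : ℝ))) ^ (1 / q.toReal) := by
        rw [← ENNReal.rpow_mul]; congr 1; field_simp
    _ ≤ (C * V ^ (1 / m - 1 : ℝ) * I₂) ^ (1 / q.toReal) := ENNReal.rpow_le_rpow h2 hqi
    _ = _ := by
        rw [ENNReal.mul_rpow_of_nonneg _ _ hqi, ENNReal.mul_rpow_of_nonneg _ _ hqi,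
          ENNReal.coe_mul, ENNReal.coe_rpow_of_nonneg _ hqi, hV, ENNReal.ofReal_rpow_of_pos hVpos,
          ENNReal.ofReal_rpow_of_pos (by positivity), Real.mul_rpow hω.le (by positivity),
          Real.mul_rpow (by positivity) (by positivity), ENNReal.ofReal_mul (by positivity),
          ← Real.rpow_natCast, ← Real.rpow_mul hR.le, ← Real.rpow_mul hR.le, hqr,
          mul_assoc (n : ℝ), ← mul_assoc (C ^ _ : ℝ≥0∞)]
        rfl

/-- Hölder's inequality on a set, with `v⁻¹` measured in `L^{m p'}`. -/
theorem lintegral_rpow_le_eLpNorm_mul {m : ℕ} (hm : 0 < m) (hp : 1 ≤ p) (hv : IsWeight v)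
    {f : E n → ℝ} (hf : AEStronglyMeasurable (fun x => f x * v x) volume) (B : Set (E n))
    {r : ℝ} (hr : r = 1 / m + (p⁻¹).toReal * (1 - 1 / m)) :
    (∫⁻ y in B, ‖f y‖ₑ ^ (1 / r)) ^ r
      ≤ eLpNorm (fun x => f x * v x) p volume *
        eLpNorm (fun y => (v y)⁻¹) (m * p.conjExponent) (volume.restrict B) := by
  have hm0 : (m : ℝ≥0∞) ≠ 0 := by exact_mod_cast hm.ne'
  have hπ := toReal_inv_mem_Icc hp
  have hm1 : (1 : ℝ) ≤ m := by exact_mod_cast hm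
  have hmi : 1 / (m : ℝ) ≤ 1 := by rw [div_le_one (by positivity)]; exact hm1
  have hmi0 : 0 < 1 / (m : ℝ) := by positivity
  have hr0 : 0 < r := by
    have := mul_nonneg hπ.1 (sub_nonneg.2 hmi)
    rw [hr]; linarith
  have hpt : p⁻¹ ≠ ∞ := ((ENNReal.inv_le_one.2 hp).trans_lt ENNReal.one_lt_top).ne
  have hH : ENNReal.HolderTriple p (m * p.conjExponent) (ENNReal.ofReal (1 / r)) := by
    refine ⟨?_⟩
    rw [ENNReal.mul_inv (Or.inl hm0) (Or.inl (by simp)), conjExponent_inv hp,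
      ← ENNReal.ofReal_inv_of_pos (by positivity), one_div, inv_inv, hr,
      ← ENNReal.ofReal_toReal hpt, ← ENNReal.ofReal_natCast m,
      ← ENNReal.ofReal_inv_of_pos (by positivity), ← ENNReal.ofReal_mul (by positivity),
      ENNReal.toReal_ofReal hπ.1,
      ← ENNReal.ofReal_add hπ.1 (mul_nonneg (by positivity) (by linarith [hπ.2]))]
    congr 1
    ring
  have h1 := eLpNorm_smul_le_mul_eLpNorm (p := p) (q := m * p.conjExponent)
    (r := ENNReal.ofReal (1 / r)) (μ := volume.restrict B) (f := fun y => (v y)⁻¹)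
    (φ := fun x => f x * v x)
    (hv.aestronglyMeasurable.aemeasurable.inv.aestronglyMeasurable.restrict) hf.restrict
  have e : eLpNorm ((fun x => f x * v x) • fun y => (v y)⁻¹) (ENNReal.ofReal (1 / r))
      (volume.restrict B) = (∫⁻ y in B, ‖f y‖ₑ ^ (1 / r)) ^ r := by
    rw [eLpNorm_eq_lintegral_rpow_enorm_toReal (by simpa using hr0) ENNReal.ofReal_ne_top,
      ENNReal.toReal_ofReal (by positivity), one_div_one_div]
    congr 1
    refine lintegral_congr_ae ?_
    filter_upwards [ae_restrict_of_ae hv.2] with y hy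
    simp only [Pi.smul_apply', smul_eq_mul]
    rw [mul_assoc, mul_inv_cancel₀ hy.ne', mul_one]
  rw [e] at h1
  exact h1.trans (by gcongr; exact Measure.restrict_le_self)

theorem eLpNorm_inv_restrict_ball_le {ρ₀ κ R e : ℝ} (hρ₀ : 0 < ρ₀) (hR : 0 < R)
    (he : 0 ≤ e) (xB : E n) :
    eLpNorm (fun y => (v y)⁻¹) p.conjExponent (volume.restrict (Metric.ball xB (κ * R)))
      ≤ ENNReal.ofReal (((ρ₀ + κ) * R) ^ e) * tailNorm ρ₀ e p v xB R := by
  have h : ∀ᵐ y ∂(volume.restrict (Metric.ball xB (κ * R))), ‖(v y)⁻¹‖ ≤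
      ((ρ₀ + κ) * R) ^ e * ‖(v y)⁻¹ / (ρ₀ * R + ‖xB - y‖) ^ e‖ := by
    filter_upwards [ae_restrict_mem Metric.isOpen_ball.measurableSet] with y hy
    have hy' : ‖xB - y‖ < κ * R := by
      rw [norm_sub_rev, ← dist_eq_norm]; exact hy
    have hD : 0 < ρ₀ * R + ‖xB - y‖ := by positivity
    have hDe : 0 < (ρ₀ * R + ‖xB - y‖) ^ e := Real.rpow_pos_of_pos hD e
    rw [norm_div, Real.norm_of_nonneg hDe.le, mul_div_assoc', le_div_iff₀ hDe, mul_comm]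
    gcongr
    linarith
  exact (eLpNorm_le_mul_eLpNorm_of_ae_le_mul h _).trans
    (by rw [tailNorm]; gcongr; exact Measure.restrict_le_self)

/-- Hölder's inequality with the exponents `p` and `p'`. -/
theorem lintegral_enorm_div_le (hp : 1 ≤ p) (hv : IsWeight v) {f : E n → ℝ}
    (hf : AEStronglyMeasurable (fun x => f x * v x) volume) (ρ₀ e : ℝ) (xB : E n) (R : ℝ) :
    ∫⁻ y, ‖f y / (ρ₀ * R + ‖xB - y‖) ^ e‖ₑ
      ≤ eLpNorm (fun x => f x * v x) p volume * tailNorm ρ₀ e p v xB R := by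
  have := ENNReal.HolderConjugate.conjExponent hp
  have hD : Measurable fun y : E n => (ρ₀ * R + ‖xB - y‖) ^ e := by fun_prop
  have h1 := eLpNorm_smul_le_mul_eLpNorm (p := p) (q := p.conjExponent)
    (r := 1) (μ := (volume : Measure (E n))) (f := fun y => (v y)⁻¹ / (ρ₀ * R + ‖xB - y‖) ^ e)
    (φ := fun x => f x * v x)
    (hv.aestronglyMeasurable.aemeasurable.inv.div hD.aemeasurable).aestronglyMeasurable hf
  refine le_trans (le_of_eq ?_) h1
  rw [eLpNorm_one_eq_lintegral_enorm]
  refine lintegral_congr_ae ?_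
  filter_upwards [hv.2] with y hy
  simp only [Pi.smul_apply', smul_eq_mul]
  congr 1
  field_simp

/-- The `L^m` norm of a truncated fractional integral of `f` over a ball. -/
theorem exists_lintegral_truncKernel_le {m : ℕ} (hn : 0 < n) (hm : 0 < m) (hp : 1 ≤ p)
    (hv : IsWeight v)
    (hRH : 1 < p → ReverseHolder m (fun x => v x ^ (-p.conjExponent.toReal)))
    {a ρ₀ κ e τ : ℝ} (ha : a < n) (hρ₀ : 0 < ρ₀) (hκ : 1 ≤ κ) (he : 0 ≤ e)
    (hτ : τ = (p⁻¹).toReal * (1 - 1 / m)) :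
    ∃ C : ℝ≥0, ∀ f : E n → ℝ, AEStronglyMeasurable (fun x => f x * v x) volume →
      ∀ (xB : E n) (R : ℝ), 0 < R →
      (∫⁻ x, (∫⁻ y, truncKernel a ((κ + 1) * R) (x - y) ^ (1 - τ) *
          (Metric.ball xB (κ * R)).indicator (fun y => ‖f y‖ₑ) y) ^ (m : ℝ)) ^ (1 / m : ℝ)
        ≤ C * ENNReal.ofReal (R ^ ((n - a) * (1 - τ)
            + n * ((1 / m - 1) * (1 - (p⁻¹).toReal)) + e)) *
          (eLpNorm (fun x => f x * v x) p volume * tailNorm ρ₀ e p v xB R) := by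
  obtain ⟨C₁, hC₁⟩ := exists_eLpNorm_inv_le_of_reverseHolder hm hp hv hRH
  have hπ := toReal_inv_mem_Icc hp
  have hm1 : (1 : ℝ) ≤ m := by exact_mod_cast hm
  have hmi : 1 / (m : ℝ) ≤ 1 := by rw [div_le_one (by positivity)]; exact hm1
  have hmi0 : 0 < 1 / (m : ℝ) := by positivity
  have hτ0 : 0 ≤ τ := hτ ▸ mul_nonneg hπ.1 (by linarith)
  have hτ1 : τ ≤ 1 - 1 / m := by
    rw [hτ]; exact mul_le_of_le_one_left (by linarith) hπ.2
  have hr0 : 0 < 1 / (m : ℝ) + τ := by linarith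
  have h1τ : 0 ≤ 1 - τ := by linarith
  set I := ∫⁻ u : E n, truncKernel a 1 u with hI
  have hIt : I ≠ ∞ := (lintegral_truncKernel_one_lt_top hn ha).ne
  set s : ℝ := n * ((1 / m - 1) * (1 - (p⁻¹).toReal)) with hs
  refine ⟨(I ^ (1 - τ)).toNNReal * Real.toNNReal (((κ + 1) ^ (n - a)) ^ (1 - τ)) *
    (C₁ * Real.toNNReal (κ ^ s) * Real.toNNReal ((ρ₀ + κ) ^ e)), fun f hf xB R hR => ?_⟩
  have hfm : AEMeasurable f volume := hv.aemeasurable_of_mul hf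
  have hκ0 : 0 < κ := by linarith
  set B := Metric.ball xB (κ * R) with hB
  have hBm : MeasurableSet B := Metric.isOpen_ball.measurableSet
  set φ := B.indicator fun y => ‖f y‖ₑ with hφ
  have hφm : AEMeasurable φ volume := hfm.enorm.indicator hBm
  have hY := lintegral_convolution_rpow_le (measurable_truncKernel (n := n) a ((κ + 1) * R))
    (hφm.pow_const (1 / (1 / (m : ℝ) + τ))) (by positivity : (0 : ℝ) < m) hτ0 hτ1
  simp_rw [← ENNReal.rpow_mul, one_div_mul_cancel hr0.ne', ENNReal.rpow_one] at hY
  refine hY.trans ?_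
  have e1 : ∫⁻ y, φ y ^ (1 / (1 / (m : ℝ) + τ)) = ∫⁻ y in B, ‖f y‖ₑ ^ (1 / (1 / (m : ℝ) + τ)) := by
    rw [← lintegral_indicator hBm]
    refine lintegral_congr fun y => ?_
    by_cases hy : y ∈ B
    · simp [hφ, hy]
    · rw [hφ, indicator_of_notMem hy, indicator_of_notMem hy, ENNReal.zero_rpow_of_pos
        (by positivity)]
  have h2 := lintegral_rpow_le_eLpNorm_mul hm hp hv hf B (r := 1 / (m : ℝ) + τ) (by rw [hτ])
  have h3 := (hC₁ xB (κ * R) (by positivity)).trans (mul_le_mul_right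
    (eLpNorm_inv_restrict_ball_le (v := v) (p := p) (κ := κ) hρ₀ hR he xB) _)
  have hκR : 0 < (κ + 1) * R := by positivity
  rw [e1, lintegral_truncKernel a hκR, ENNReal.mul_rpow_of_nonneg _ _ h1τ]
  set F := eLpNorm (fun x => f x * v x) p volume
  set N := tailNorm ρ₀ e p v xB R
  refine (mul_le_mul_right (h2.trans (mul_le_mul_right h3 _)) _).trans_eq ?_
  rw [Real.mul_rpow hκ0.le hR.le, Real.mul_rpow (by positivity) hR.le,
    Real.mul_rpow (by positivity) hR.le, ENNReal.ofReal_rpow_of_pos (by positivity),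
    Real.mul_rpow (by positivity) (by positivity), ← Real.rpow_mul hR.le,
    Real.rpow_add hR, Real.rpow_add hR, ENNReal.ofReal_mul (by positivity),
    ENNReal.ofReal_mul (by positivity), ENNReal.ofReal_mul (by positivity),
    ENNReal.ofReal_mul (by positivity), ENNReal.ofReal_mul (by positivity)]
  push_cast
  rw [ENNReal.coe_toNNReal (ENNReal.rpow_ne_top_of_nonneg h1τ hIt)]
  simp only [← ENNReal.ofReal.eq_1]
  ring

end OneWeight

/-! ### Differences of the commutator on a ball -/

/-- The condition `p > n / (α + m δ)` allows the singularity of order `m n - (α + m δ)` to be split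
into `m` singularities which are locally integrable even after raising to Young's exponents. -/
theorem exists_splitting_exponent {m : ℕ} {n a : ℝ} (hm : 0 < m) (hn : 0 < n)
    (ha' : a < m * n) {π : Fin m → ℝ} (hπ0 : ∀ i, 0 ≤ π i) (hsum : ∑ i, π i < a / n) :
    ∃ θ : ℝ, 0 < θ ∧ θ < n ∧ ∑ i, θ * (1 - π i * (1 - 1 / m)) = m * n - a := by
  have hm1 : (1 : ℝ) ≤ m := by exact_mod_cast hm
  have hmi : 0 ≤ 1 / (m : ℝ) := by positivity
  have hS : ∑ i, (1 - π i * (1 - 1 / (m : ℝ))) = m - (∑ i, π i) * (1 - 1 / m) := by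
    rw [Finset.sum_sub_distrib, Finset.sum_mul]; simp
  have hlt : (m * n - a) / n < ∑ i, (1 - π i * (1 - 1 / (m : ℝ))) := by
    rw [hS, sub_div, mul_div_cancel_right₀ _ hn.ne']
    have h0 : 0 ≤ ∑ i, π i := Finset.sum_nonneg fun i _ => hπ0 i
    nlinarith
  have hpos : 0 < (m * n - a) / n := div_pos (by linarith) hn
  have h_sum := hpos.trans hlt
  refine ⟨(m * n - a) / ∑ i, (1 - π i * (1 - 1 / (m : ℝ))), div_pos (by linarith) h_sum, ?_, ?_⟩
  · rw [div_lt_iff₀ h_sum]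
    rw [div_lt_iff₀ hn] at hlt
    linarith
  · rw [← Finset.mul_sum, div_mul_cancel₀ _ h_sum.ne']

/-- On a ball, the differences of the commutator are dominated by `h x + h z + M`: the function
`h` is a product of truncated fractional integrals, and bounds the part of the integral where all
`y i` are close to the ball; the constant `M` comes from the smoothness of the kernel. -/
theorem exists_lintegral_commIntegrand_sub_le {n m : ℕ} {α γ δ A L : ℝ}
    {K : E n → (Fin m → E n) → ℝ} {b : Fin m → E n → ℝ} (hn : 0 < n) (hm : 0 < m)
    (hδ : 0 < δ) (hδγ : δ ≤ γ) (hα' : α + m * δ < (m : ℝ) * n)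
    (hsize : ∀ x y, 0 < ∑ i, ‖x - y i‖ → |K x y| ≤ A / (∑ i, ‖x - y i‖) ^ ((m : ℝ) * n - α))
    (hsmooth : SmoothnessCondition α γ K) (hA : 0 ≤ A) (hL : 0 < L)
    (hb : ∀ i x y, |b i x - b i y| ≤ L * ‖x - y‖ ^ δ) {p : Fin m → ℝ≥0∞} (hp : ∀ i, 1 ≤ p i)
    (hp' : ∑ i, ((p i)⁻¹).toReal < (α + m * δ) / n) {v : Fin m → E n → ℝ}
    (hv : ∀ i, IsWeight (v i))
    (hRH : ∀ i, 1 < p i → ReverseHolder m (fun x => v i x ^ (-(p i).conjExponent.toReal)))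
    {ρ₀ : ℝ} (hρ₀ : 0 < ρ₀) {e : Fin m → ℝ} (he : ∀ i, 0 ≤ e i)
    (hsum : ∑ i, e i = m * n - α - m * δ + δ) :
    ∃ C : ℝ≥0, ∀ f : Fin m → E n → ℝ,
      (∀ i, AEStronglyMeasurable (fun x => f i x * v i x) volume) →
      ∀ (xB : E n) (R : ℝ), 0 < R → ∃ (h : E n → ℝ≥0∞) (M : ℝ≥0∞), AEMeasurable h volume ∧
        (∀ x ∈ Metric.ball xB R, ∀ z ∈ Metric.ball xB R,
          ∫⁻ y, ‖commIntegrand K b f x y - commIntegrand K b f z y‖ₑ ≤ h x + h z + M) ∧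
        2 * (∫⁻ x in Metric.ball xB R, h x) + M * volume (Metric.ball xB R)
          ≤ C * ENNReal.ofReal (R ^ (n + δ)) *
            ∏ i, (eLpNorm (fun x => f i x * v i x) (p i) volume *
              tailNorm ρ₀ (e i) (p i) (v i) xB R) := by
  have hm1 : (1 : ℝ) ≤ m := by exact_mod_cast hm
  have hn0 : (0 : ℝ) < n := by exact_mod_cast hn
  have hmi : 1 / (m : ℝ) ≤ 1 := by rw [div_le_one (by positivity)]; exact hm1
  have hπ := fun i => toReal_inv_mem_Icc (hp i)
  obtain ⟨a, ha0, ha, hasum⟩ := exists_splitting_exponent hm hn0 hα'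
    (fun i => (hπ i).1) hp'
  set τ : Fin m → ℝ := fun i => ((p i)⁻¹).toReal * (1 - 1 / m) with hτ
  have hτ1 : ∀ i, 0 ≤ 1 - τ i := fun i => by
    have h1 : τ i ≤ 1 * (1 - 1 / m) :=
      mul_le_mul_of_nonneg_right (hπ i).2 (by linarith)
    have h2 : 0 ≤ 1 / (m : ℝ) := by positivity
    linarith
  obtain ⟨C₂, hC₂, κ, hκ, hfar⟩ := exists_enorm_commIntegrand_sub_le hδ hδγ
    (by nlinarith : α < (m : ℝ) * n) hsize hsmooth hA hL hb hρ₀ he hsum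
  choose C₁ hC₁ using fun i => exists_lintegral_truncKernel_le hn hm (hp i) (hv i) (hRH i) ha hρ₀
    hκ (he i) (rfl : τ i = _)
  obtain ⟨ω, hω, hvol⟩ := exists_volume_ball_eq n
  set c : ℝ≥0 := Real.toNNReal (A * L ^ m) with hc
  refine ⟨2 * c * ∏ i, C₁ i + Real.toNNReal (C₂ * ω), fun f hf xB R hR => ?_⟩
  have hfm : ∀ i, AEMeasurable (f i) volume := fun i => (hv i).aemeasurable_of_mul (hf i)
  set φ : Fin m → E n → ℝ≥0∞ := fun i =>
    (Metric.ball xB (κ * R)).indicator fun y => ‖f i y‖ₑ with hφ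
  have hφm : ∀ i, AEMeasurable (φ i) volume := fun i =>
    (hfm i).enorm.indicator Metric.isOpen_ball.measurableSet
  set k : E n → ℝ≥0∞ := truncKernel a ((κ + 1) * R) with hk
  have hkm : Measurable k := measurable_truncKernel _ _
  set G : Fin m → E n → ℝ≥0∞ := fun i x => ∫⁻ y, k (x - y) ^ (1 - τ i) * φ i y with hG
  have hGm : ∀ i, AEMeasurable (G i) volume := fun i =>
    AEMeasurable.lintegral_prod_right'
      (f := fun z : E n × E n => k (z.1 - z.2) ^ (1 - τ i) * φ i z.2)
      (((hkm.comp (measurable_fst.sub measurable_snd)).pow_const _).aemeasurable.mul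
        ((hφm i).comp_quasiMeasurePreserving Measure.quasiMeasurePreserving_snd))
  set W : Fin m → E n → ℝ≥0∞ := fun i y => ‖f i y / (ρ₀ * R + ‖xB - y‖) ^ e i‖ₑ with hW
  have hWm : ∀ i, AEMeasurable (W i) volume := fun i =>
    ((hfm i).div (by fun_prop : Measurable fun y : E n =>
      (ρ₀ * R + ‖xB - y‖) ^ e i).aemeasurable).enorm
  have hpm : ∀ {ψ : Fin m → E n → ℝ≥0∞}, (∀ i, AEMeasurable (ψ i) volume) →
      AEMeasurable (fun y : Fin m → E n => ∏ i, ψ i (y i)) volume := fun {ψ} hψ =>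
    Finset.aemeasurable_fun_prod _ fun i _ => (hψ i).comp_quasiMeasurePreserving
      (Measure.quasiMeasurePreserving_eval (fun _ : Fin m => (volume : Measure (E n))) i)
  have hkφ : ∀ (x : E n) (i : Fin m),
      AEMeasurable (fun y => k (x - y) ^ (1 - τ i) * φ i y) volume := fun x i =>
    ((hkm.comp (measurable_const.sub measurable_id)).pow_const _).aemeasurable.mul (hφm i)
  -- the size estimate, for points of the ball
  have hnear : ∀ x ∈ Metric.ball xB R, ∀ y : Fin m → E n,
      (∀ i, y i ∈ Metric.ball xB (κ * R)) → ‖commIntegrand K b f x y‖ₑ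
        ≤ c * ∏ i, (k (x - y i) ^ (1 - τ i) * φ i (y i)) := by
    intro x hx y hy
    refine (enorm_commIntegrand_le hm hA hL.le hδ hsize hb
      (fun i => mul_nonneg ha0.le (hτ1 i)) hasum f x y).trans_eq ?_
    refine congrArg₂ _ rfl (Finset.prod_congr rfl fun i _ => ?_)
    have hxy : ‖x - y i‖ < (κ + 1) * R := by
      have h1 := dist_triangle_right x (y i) xB
      have h2 := hy i
      rw [Metric.mem_ball] at hx h2
      rw [← dist_eq_norm]
      linarith
    rw [hk, truncKernel_of_mem hxy, ← ENNReal.rpow_mul, neg_mul, hφ]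
    simp only [indicator_of_mem (hy i)]
  refine ⟨fun x => c * ∏ i, G i x, ENNReal.ofReal (C₂ * R ^ δ) * ∏ i, ∫⁻ y, W i y,
    (Finset.aemeasurable_fun_prod _ fun i _ => hGm i).const_mul _, fun x hx z hz => ?_, ?_⟩
  · have hP : ∀ u : E n, ∫⁻ y : Fin m → E n, c * ∏ i, (k (u - y i) ^ (1 - τ i) * φ i (y i))
        = c * ∏ i, G i u := fun u => by
      rw [lintegral_const_mul' _ _ ENNReal.coe_ne_top, lintegral_fin_prod_eq_prod (hkφ u)]
    beta_reduce
    rw [← hP x, ← hP z, ← lintegral_fin_prod_eq_prod hWm,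
      ← lintegral_const_mul' _ _ ENNReal.ofReal_ne_top,
      ← lintegral_add_left' ((hpm (hkφ x)).const_mul _),
      ← lintegral_add_right' _ ((hpm hWm).const_mul _)]
    refine lintegral_mono fun y => ?_
    by_cases hy : ∀ i, y i ∈ Metric.ball xB (κ * R)
    · exact enorm_sub_le.trans ((add_le_add (hnear x hx y hy) (hnear z hz y hy)).trans
        le_self_add)
    · push Not at hy
      exact (hfar f xB R hR x hx z hz y hy).trans le_add_self
  · set P := ∏ i, (eLpNorm (fun x => f i x * v i x) (p i) volume *
      tailNorm ρ₀ (e i) (p i) (v i) xB R) with hPdef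
    have h1 : ∫⁻ x in Metric.ball xB R, (c : ℝ≥0∞) * ∏ i, G i x
        ≤ c * ((∏ i, (C₁ i : ℝ≥0∞)) * ENNReal.ofReal (R ^ (n + δ)) * P) := by
      rw [lintegral_const_mul' _ _ ENNReal.coe_ne_top]
      gcongr
      refine (setLIntegral_le_lintegral _ _).trans
        ((lintegral_prod_le_prod_rpow hm hGm).trans ?_)
      refine (Finset.prod_le_prod' fun i _ => hC₁ i (f i) (hf i) xB R hR).trans_eq ?_
      rw [Finset.prod_mul_distrib, Finset.prod_mul_distrib,
        ← ENNReal.ofReal_prod_of_nonneg (fun i _ => by positivity), ← Real.rpow_sum_of_pos hR]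
      congr 4
      have h_sum : ∑ i, (1 - τ i) = m - (∑ i, ((p i)⁻¹).toReal) * (1 - 1 / m) := by
        rw [Finset.sum_sub_distrib, hτ, ← Finset.sum_mul]; simp
      have h_sum' : ∑ i, (1 - ((p i)⁻¹).toReal) = m - ∑ i, ((p i)⁻¹).toReal := by
        rw [Finset.sum_sub_distrib]; simp
      have h_a : a * ∑ i, (1 - τ i) = m * n - (α + m * δ) := by
        rw [Finset.mul_sum]; exact hasum
      rw [Finset.sum_add_distrib, Finset.sum_add_distrib, hsum, ← Finset.mul_sum,
        ← Finset.mul_sum, ← Finset.mul_sum, sub_mul, h_a, h_sum, h_sum']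
      field_simp
      ring
    have h2 : (ENNReal.ofReal (C₂ * R ^ δ) * ∏ i, ∫⁻ y, W i y) * volume (Metric.ball xB R)
        ≤ ENNReal.ofReal (C₂ * ω) * ENNReal.ofReal (R ^ (n + δ)) * P := by
      have e1 : ENNReal.ofReal (C₂ * ω) * ENNReal.ofReal (R ^ (n + δ))
          = ENNReal.ofReal (C₂ * R ^ δ) * ENNReal.ofReal (ω * R ^ n) := by
        rw [← ENNReal.ofReal_mul (by positivity), ← ENNReal.ofReal_mul (by positivity),
          Real.rpow_add hR, Real.rpow_natCast]
        congr 1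
        ring
      rw [hvol xB R hR, e1, mul_right_comm]
      gcongr
      exact Finset.prod_le_prod' fun i _ =>
        lintegral_enorm_div_le (hp i) (hv i) (hf i) ρ₀ (e i) xB R
    calc _ ≤ 2 * (c * ((∏ i, (C₁ i : ℝ≥0∞)) * ENNReal.ofReal (R ^ (n + δ)) * P))
          + ENNReal.ofReal (C₂ * ω) * ENNReal.ofReal (R ^ (n + δ)) * P := by gcongr
      _ = _ := by
          push_cast
          rw [show ((Real.toNNReal (C₂ * ω) : ℝ≥0) : ℝ≥0∞) = ENNReal.ofReal (C₂ * ω) from rfl]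
          ring

/-! ### The commutator modulo constants -/

/-- If the differences `F x - F z` are integrable for `x`, `z` in a conull set, then their integrals
are the differences of a measurable function. -/
theorem exists_sub_eq_integral_sub {X Y : Type*} [MeasurableSpace X] [MeasurableSpace Y]
    {μ : Measure X} {ν : Measure Y} [SFinite μ] [SFinite ν] [NeZero μ] {F : X → Y → ℝ}
    (hF : AEStronglyMeasurable (Function.uncurry F) (μ.prod ν)) {S : Set X}
    (hS : ∀ᵐ x ∂μ, x ∈ S)
    (hint : ∀ x ∈ S, ∀ z ∈ S, Integrable (fun y => F x y - F z y) ν) :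
    ∃ g : X → ℝ, AEStronglyMeasurable g μ ∧ ∀ᵐ x ∂μ, ∀ᵐ z ∂μ,
      Integrable (fun y => F x y - F z y) ν ∧ g x - g z = ∫ y, (F x y - F z y) ∂ν := by
  obtain ⟨z₀, hz₀, hmz⟩ := (hS.and hF.prodMk_left).exists
  refine ⟨fun x => ∫ y, (F x y - F z₀ y) ∂ν, ?_, ?_⟩
  · exact (hF.sub (hmz.comp_quasiMeasurePreserving
      Measure.quasiMeasurePreserving_snd)).integral_prod_right'
  · filter_upwards [hS] with x hx
    filter_upwards [hS] with z hz
    refine ⟨hint x hx z hz, ?_⟩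
    rw [← integral_sub (hint x hx z₀ hz₀) (hint z hz z₀ hz₀)]
    simp

theorem IsLip.measurable {n : ℕ} {δ : ℝ} (hδ : 0 < δ) {b : E n → ℝ} (hb : IsLip δ b) :
    Measurable b := by
  obtain ⟨L, hL⟩ := hb
  refine Continuous.measurable (continuous_iff_continuousAt.2 fun x => ?_)
  rw [ContinuousAt, tendsto_iff_norm_sub_tendsto_zero]
  refine squeeze_zero (fun _ => norm_nonneg _) (fun y => hL y x) ?_
  have : ContinuousAt (fun y : E n => L * ‖y - x‖ ^ δ) x := by
    have h1 : ContinuousAt (fun y : E n => ‖y - x‖) x := by fun_prop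
    exact continuousAt_const.mul (h1.rpow_const (Or.inr hδ.le))
  simpa [ContinuousAt, Real.zero_rpow hδ.ne'] using this

theorem aestronglyMeasurable_commIntegrand {n m : ℕ} {K : E n → (Fin m → E n) → ℝ}
    (hK : AEStronglyMeasurable (Function.uncurry K) (volume.prod volume))
    {b f : Fin m → E n → ℝ} (hb : ∀ i, Measurable (b i)) (hf : ∀ i, AEMeasurable (f i) volume) :
    AEStronglyMeasurable (Function.uncurry (commIntegrand K b f)) (volume.prod volume) := by
  refine (hK.aemeasurable.mul (Finset.aemeasurable_fun_prod _ fun i _ => ?_)).aestronglyMeasurable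
  refine AEMeasurable.mul (Measurable.aemeasurable (by fun_prop)) ?_
  exact ((hf i).comp_quasiMeasurePreserving (Measure.quasiMeasurePreserving_eval
    (fun _ : Fin m => (volume : Measure (E n))) i)).comp_quasiMeasurePreserving
    Measure.quasiMeasurePreserving_snd

/-- Each norm in the class `ClassH` is finite: the product of these norms is finite since
`w⁻¹(B) < ∞`, and no factor vanishes. -/
theorem tailNorm_lt_top {n m : ℕ} {p : Fin m → ℝ≥0∞} (hp : ∀ i, 1 ≤ p i) {v : Fin m → E n → ℝ}
    (hv : ∀ i, IsWeight (v i)) {ρ₀ : ℝ} (hρ₀ : 0 < ρ₀) {e : Fin m → ℝ} {xB : E n} {R : ℝ}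
    (hR : 0 < R) {a : ℝ≥0∞} (ha : a ≠ 0)
    (h : a * ∏ i, tailNorm ρ₀ (e i) (p i) (v i) xB R ≠ ∞) (i : Fin m) :
    tailNorm ρ₀ (e i) (p i) (v i) xB R < ∞ := by
  have h0 : ∀ j, tailNorm ρ₀ (e j) (p j) (v j) xB R ≠ 0 := by
    intro j hj
    have hconj := ENNReal.HolderConjugate.conjExponent (hp j)
    have hD : Measurable fun y : E n => (ρ₀ * R + ‖xB - y‖) ^ e j := by fun_prop
    have hj' := (eLpNorm_eq_zero_iff ((hv j).aestronglyMeasurable.aemeasurable.inv.div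
      hD.aemeasurable).aestronglyMeasurable (ENNReal.HolderConjugate.ne_zero _ (p j))).1 hj
    obtain ⟨y, hy, hy'⟩ := (hj'.and (hv j).2).exists
    have : 0 < (v j y)⁻¹ / (ρ₀ * R + ‖xB - y‖) ^ e j := by positivity
    exact this.ne' hy
  refine lt_top_iff_ne_top.2 fun hi => h ?_
  have : ∏ i, tailNorm ρ₀ (e i) (p i) (v i) xB R = ∞ := by
    classical
    rw [Fintype.prod_eq_mul_prod_compl i, hi,
      ENNReal.top_mul (Finset.prod_ne_zero_iff.2 fun j _ => h0 j)]
  rw [this, ENNReal.mul_top ha]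

/-- The conditions of the class `ClassH` turn a bound for the mean oscillation in terms of the
norms `tailNorm` into a bound in the seminorm of `L_w(δ')`. -/
theorem lipOsc_le {n : ℕ} (hn : 0 < n) {ω : ℝ} (hω : 0 < ω) {w g : E n → ℝ} {δ δ' : ℝ} {xB : E n}
    {R : ℝ} (hR : 0 < R) (hvol : volume (Metric.ball xB R) = ENNReal.ofReal (ω * R ^ n))
    {C C' : ℝ≥0} {N P : ℝ≥0∞}
    (hg : ∫⁻ x in Metric.ball xB R, ‖g x - ⨍ z in Metric.ball xB R, g z‖ₑ
      ≤ C * ENNReal.ofReal (R ^ (n + δ)) * (P * N))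
    (hH : volume (Metric.ball xB R) ^ (1 + (δ - δ') / n) / invMass w xB R * N ≤ C') :
    lipOsc w δ' g xB R ≤ (C * Real.toNNReal (ω ^ (-(1 + δ / n))) * C' : ℝ≥0) * P := by
  have hn0 : (0 : ℝ) < n := by exact_mod_cast hn
  set V := volume (Metric.ball xB R) with hV
  have hVpos : 0 < ω * R ^ n := by positivity
  have hV0 : V ≠ 0 := by rw [hvol]; simpa using hVpos
  have hVt : V ≠ ∞ := by rw [hvol]; exact ENNReal.ofReal_ne_top
  have e1 : ENNReal.ofReal (R ^ (n + δ)) = ENNReal.ofReal (ω ^ (-(1 + δ / n))) *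
      (V ^ (1 + (δ - δ') / n) * V ^ (δ' / n)) := by
    rw [← ENNReal.rpow_add _ _ hV0 hVt, hvol, ENNReal.ofReal_rpow_of_pos hVpos,
      ← ENNReal.ofReal_mul (by positivity), Real.mul_rpow hω.le (by positivity),
      ← Real.rpow_natCast, ← Real.rpow_mul hR.le, ← mul_assoc, ← Real.rpow_add hω,
      show -(1 + δ / n) + (1 + (δ - δ') / n + δ' / n) = 0 by ring, Real.rpow_zero, one_mul]
    congr 2
    field_simp
    ring
  have hV' : V ^ (δ' / n) ≠ 0 := by simp [ENNReal.rpow_eq_zero_iff, hV0, hVt]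
  have hV'' : V ^ (δ' / n) ≠ ∞ := by simp [ENNReal.rpow_eq_top_iff, hV0, hVt]
  rw [lipOsc, ← hV]
  calc _ ≤ (C * ENNReal.ofReal (R ^ (n + δ)) * (P * N)) / (invMass w xB R * V ^ (δ' / n)) := by
        gcongr
    _ = ((C * ENNReal.ofReal (ω ^ (-(1 + δ / n))) * P * V ^ (1 + (δ - δ') / n) * N)
        * V ^ (δ' / n)) / (invMass w xB R * V ^ (δ' / n)) := by
        rw [e1]; congr 1; ring
    _ = C * ENNReal.ofReal (ω ^ (-(1 + δ / n))) * P *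
        (V ^ (1 + (δ - δ') / n) / invMass w xB R * N) := by
        rw [ENNReal.mul_div_mul_right _ _ hV' hV'']
        simp only [div_eq_mul_inv]
        ring
    _ ≤ C * ENNReal.ofReal (ω ^ (-(1 + δ / n))) * P * C' := by gcongr
    _ = _ := by
        push_cast
        rw [show ((Real.toNNReal (ω ^ (-(1 + δ / n))) : ℝ≥0) : ℝ≥0∞)
          = ENNReal.ofReal (ω ^ (-(1 + δ / n))) from rfl]
        ring

end FracComm

open FracComm
theorem theorem1p2 {n m : ℕ} (α γ δ δ' : ℝ)
    (hα : 0 < α) (hα' : α < (m : ℝ) * n) (hγ : 0 < γ) (hγ' : γ ≤ 1)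
    (K : E n → (Fin m → E n) → ℝ)
    (hK : AEStronglyMeasurable (Function.uncurry K) (volume.prod volume))
    (hsize : SizeCondition α K) (hsmooth : SmoothnessCondition α γ K)
    (hδ : 0 < δ) (hδ' : δ < min γ (((m : ℝ) * n - α) / m))
    (p : Fin m → ℝ≥0∞) (hp : ∀ i, 1 ≤ p i)
    (hp' : ENNReal.ofReal (n / (α + m * δ)) < (∑ i, (p i)⁻¹)⁻¹)
    (b : Fin m → E n → ℝ) (hb : ∀ i, IsLip δ (b i))
    (hδδ' : δ' ≤ δ)
    (w : E n → ℝ) (v : Fin m → E n → ℝ) (hw : IsWeight w) (hv : ∀ i, IsWeight (v i))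
    (hH : ClassH p (α + m * δ) δ δ' w v)
    (hRH : ∀ i, 1 < p i → ReverseHolder m (fun x => v i x ^ (-(p i).conjExponent.toReal))) :
    ∃ C : ℝ≥0, 0 < C ∧ ∀ f : Fin m → E n → ℝ,
      (∀ i, MemLp (fun x => f i x * v i x) (p i) volume) →
      -- the estimate for the commutator, whenever its defining integrals converge absolutely
      ((∀ᵐ x, CommConvergesAt K b f x) →
        LocallyIntegrable (prodComm b (multOp K) f) volume ∧
        ∀ (xB : E n) (R : ℝ), 0 < R →
          lipOsc w δ' (prodComm b (multOp K) f) xB R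
            ≤ C * ∏ i, eLpNorm (fun x => f i x * v i x) (p i) volume) ∧
      -- for arbitrary `f`, the estimate for the commutator defined modulo additive constants
      (∃ g : E n → ℝ, LocallyIntegrable g volume ∧
        (∀ᵐ x, ∀ᵐ z,
          Integrable (fun y => commIntegrand K b f x y - commIntegrand K b f z y) volume ∧
          g x - g z = ∫ y, (commIntegrand K b f x y - commIntegrand K b f z y)) ∧
        ∀ (xB : E n) (R : ℝ), 0 < R →
          lipOsc w δ' g xB R
            ≤ C * ∏ i, eLpNorm (fun x => f i x * v i x) (p i) volume) := by
  have hmn : 0 < (m : ℝ) * n := hα.trans hα'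
  have hn : 0 < n := Nat.pos_of_ne_zero fun h => by simp [h] at hmn
  have hm : 0 < m := Nat.pos_of_ne_zero fun h => by simp [h] at hmn
  have hn0 : (0 : ℝ) < n := by exact_mod_cast hn
  have hm0 : (0 : ℝ) < m := by exact_mod_cast hm
  have hδγ : δ ≤ γ := (hδ'.trans_le (min_le_left _ _)).le
  have hαδ : α + m * δ < m * n := by
    have := hδ'.trans_le (min_le_right _ _)
    rw [lt_div_iff₀ hm0] at this
    linarith
  have hαδ0 : 0 < α + m * δ := by positivity
  -- the condition on `p` in terms of the real numbers `1 / p i`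
  have hpsum : ∑ i, ((p i)⁻¹).toReal < (α + m * δ) / n := by
    rw [ENNReal.lt_inv_iff_lt_inv, ← ENNReal.ofReal_inv_of_pos (by positivity), inv_div] at hp'
    have := ENNReal.toReal_lt_of_lt_ofReal hp'
    rwa [ENNReal.toReal_sum fun i _ =>
      ((ENNReal.inv_le_one.2 (hp i)).trans_lt ENNReal.one_lt_top).ne] at this
  obtain ⟨A, hA⟩ := hsize
  have hA' : ∀ x y, 0 < ∑ i, ‖x - y i‖ → |K x y| ≤ |A| / (∑ i, ‖x - y i‖) ^ ((m : ℝ) * n - α) :=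
    fun x y hxy => (hA x y hxy).trans (by gcongr; exact le_abs_self A)
  choose Lb hLb using hb
  have hL : ∀ i x y, |b i x - b i y| ≤ (1 + ∑ j, |Lb j|) * ‖x - y‖ ^ δ := fun i x y => by
    refine (hLb i x y).trans (mul_le_mul_of_nonneg_right ?_ (by positivity))
    have := Finset.single_le_sum (f := fun j => |Lb j|) (fun j _ => abs_nonneg _)
      (Finset.mem_univ i)
    linarith [le_abs_self (Lb i)]
  have hLpos : 0 < 1 + ∑ j, |Lb j| := by positivity
  obtain ⟨ω, hω, hvol⟩ := exists_volume_ball_eq n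
  obtain ⟨hwfin, βs, hβ, hβsum, CH, hCH⟩ := hH
  set ρ₀ : ℝ := ω ^ (1 / (n : ℝ)) with hρ₀
  have hρ₀pos : 0 < ρ₀ := Real.rpow_pos_of_pos hω _
  set e : Fin m → ℝ := fun i => n - βs i + δ / m with he
  have he0 : ∀ i, 0 ≤ e i := fun i => by
    have h1 : 0 ≤ δ / m := by positivity
    have h2 := (hβ i).2
    simp only [he]
    linarith
  have hesum : ∑ i, e i = m * n - α - m * δ + δ := by
    simp only [he]
    rw [Finset.sum_add_distrib, Finset.sum_sub_distrib, hβsum]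
    simp only [Finset.sum_const, Finset.card_univ, Fintype.card_fin, nsmul_eq_mul]
    field_simp
    ring
  have hCH' : ∀ (xB : E n) (R : ℝ), 0 < R →
      volume (Metric.ball xB R) ^ (1 + (δ - δ') / n) / invMass w xB R *
        ∏ i, tailNorm ρ₀ (e i) (p i) (v i) xB R ≤ CH := by
    intro xB R hR
    refine le_of_eq_of_le ?_ (hCH xB R hR)
    have : volume.real (Metric.ball xB R) ^ (1 / (n : ℝ)) = ρ₀ * R := by
      rw [measureReal_def, hvol xB R hR, ENNReal.toReal_ofReal (by positivity),
        Real.mul_rpow hω.le (by positivity), ← Real.rpow_natCast, ← Real.rpow_mul hR.le,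
        mul_one_div_cancel hn0.ne', Real.rpow_one]
    simp only [tailNorm, he, this]
  obtain ⟨C, hC⟩ := exists_lintegral_commIntegrand_sub_le hn hm hδ hδγ hαδ hA' hsmooth
    (abs_nonneg A) hLpos hL hp hpsum hv hRH hρ₀pos he0 hesum
  refine ⟨C * Real.toNNReal (ω ^ (-(1 + δ / n))) * CH + 1, by positivity, fun f hf => ?_⟩
  have hfin : ∀ (xB : E n) (R : ℝ), 0 < R →
      ∏ i, (eLpNorm (fun x => f i x * v i x) (p i) volume * tailNorm ρ₀ (e i) (p i) (v i) xB R)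
        < ∞ := by
    intro xB R hR
    refine ENNReal.prod_lt_top fun i _ => ENNReal.mul_lt_top (hf i).2 ?_
    refine tailNorm_lt_top hp hv hρ₀pos hR ?_ ((hCH' xB R hR).trans_lt ENNReal.coe_lt_top).ne i
    have hV0 : volume (Metric.ball xB R) ≠ 0 := (Metric.measure_ball_pos _ _ hR).ne'
    simp [ENNReal.div_eq_zero_iff, ENNReal.rpow_eq_zero_iff, hV0, measure_ball_lt_top.ne,
      (hwfin xB R hR).ne]
  set F := commIntegrand K b f with hF
  have hFm : AEStronglyMeasurable (Function.uncurry F) (volume.prod volume) :=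
    aestronglyMeasurable_commIntegrand hK (fun i => IsLip.measurable hδ ⟨_, hLb i⟩)
      fun i => (hv i).aemeasurable_of_mul (hf i).1
  have key : ∀ (xB : E n) (R : ℝ), 0 < R → ∃ (h : E n → ℝ≥0∞) (M : ℝ≥0∞),
      AEMeasurable h volume ∧ ∫⁻ x in Metric.ball xB R, h x ≠ ∞ ∧ M ≠ ∞ ∧
      (∀ x ∈ Metric.ball xB R, ∀ z ∈ Metric.ball xB R,
        ∫⁻ y, ‖F x y - F z y‖ₑ ≤ h x + h z + M) ∧
      2 * (∫⁻ x in Metric.ball xB R, h x) + M * volume (Metric.ball xB R)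
        ≤ C * ENNReal.ofReal (R ^ (n + δ)) *
          ((∏ i, eLpNorm (fun x => f i x * v i x) (p i) volume) *
            ∏ i, tailNorm ρ₀ (e i) (p i) (v i) xB R) := by
    intro xB R hR
    obtain ⟨h, M, hh, h1, h2⟩ := hC f (fun i => (hf i).1) xB R hR
    have hlt := h2.trans_lt (ENNReal.mul_lt_top (ENNReal.mul_lt_top ENNReal.coe_lt_top
      ENNReal.ofReal_lt_top) (hfin xB R hR))
    rw [ENNReal.add_lt_top] at hlt
    rw [Finset.prod_mul_distrib] at h2
    refine ⟨h, M, hh, fun ht => ?_, fun ht => ?_, h1, h2⟩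
    · simp [ht] at hlt
    · simp [ht, (Metric.measure_ball_pos volume xB hR).ne'] at hlt
  -- the estimate for any function whose differences are given by `F`
  have main : ∀ g : E n → ℝ, AEStronglyMeasurable g volume →
      (∀ᵐ x, ∀ᵐ z, ‖g x - g z‖ₑ ≤ ∫⁻ y, ‖F x y - F z y‖ₑ) →
      LocallyIntegrable g volume ∧ ∀ (xB : E n) (R : ℝ), 0 < R → lipOsc w δ' g xB R
        ≤ (C * Real.toNNReal (ω ^ (-(1 + δ / n))) * CH + 1 : ℝ≥0) *
          ∏ i, eLpNorm (fun x => f i x * v i x) (p i) volume := by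
    intro g hg hgF
    have hball : ∀ (xB : E n) (R : ℝ), 0 < R → IntegrableOn g (Metric.ball xB R) volume ∧
        ∫⁻ x in Metric.ball xB R, ‖g x - ⨍ z in Metric.ball xB R, g z‖ₑ
          ≤ C * ENNReal.ofReal (R ^ (n + δ)) *
            ((∏ i, eLpNorm (fun x => f i x * v i x) (p i) volume) *
              ∏ i, tailNorm ρ₀ (e i) (p i) (v i) xB R) := by
      intro xB R hR
      obtain ⟨h, M, hh, hint, hM, h1, h2⟩ := key xB R hR
      have : IsFiniteMeasure (volume.restrict (Metric.ball xB R)) :=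
        isFiniteMeasure_restrict.2 measure_ball_lt_top.ne
      have : NeZero (volume.restrict (Metric.ball xB R)) :=
        ⟨by simpa using (Metric.measure_ball_pos volume xB hR).ne'⟩
      have hmem : ∀ᵐ x ∂(volume.restrict (Metric.ball xB R)), x ∈ Metric.ball xB R :=
        ae_restrict_mem Metric.isOpen_ball.measurableSet
      obtain ⟨hI, hO⟩ := integrable_and_lintegral_sub_average_le hg.restrict hh.restrict hint hM
        (by
          filter_upwards [ae_restrict_of_ae hgF, hmem] with x hx hxB
          filter_upwards [ae_restrict_of_ae hx, hmem] with z hz hzB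
          exact hz.trans (h1 x hxB z hzB))
      rw [Measure.restrict_apply_univ] at hO
      exact ⟨hI, hO.trans h2⟩
    refine ⟨fun x => ⟨Metric.ball x 1, Metric.ball_mem_nhds x one_pos, (hball x 1 one_pos).1⟩,
      fun xB R hR => ?_⟩
    refine (lipOsc_le hn hω hR (hvol xB R hR) (hball xB R hR).2 (hCH' xB R hR)).trans ?_
    gcongr
    exact le_self_add
  refine ⟨fun hconv => ?_, ?_⟩
  · have hcomm : ∀ᵐ x, Integrable (F x) volume ∧ prodComm b (multOp K) f x = ∫ y, F x y :=
      hconv.mono fun x hx => prodComm_eq_integral hx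
    refine main _ (hFm.integral_prod_right'.congr (hcomm.mono fun x hx => hx.2.symm)) ?_
    filter_upwards [hcomm] with x hx
    filter_upwards [hcomm] with z hz
    rw [hx.2, hz.2, ← integral_sub hx.1 hz.1]
    exact enorm_integral_le_lintegral_enorm _
  · choose h M hh hint hM hle _ using fun k : ℕ => key 0 (k + 1) (by positivity)
    have hS : ∀ᵐ x, x ∈ {x : E n | AEStronglyMeasurable (F x) volume ∧
        ∀ k : ℕ, x ∈ Metric.ball (0 : E n) (k + 1) → h k x < ∞} := by
      refine hFm.prodMk_left.and (ae_all_iff.2 fun k => ?_)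
      exact (ae_restrict_iff' Metric.isOpen_ball.measurableSet).1
        (ae_lt_top' (hh k).restrict (hint k))
    obtain ⟨g, hg, hgF⟩ := exists_sub_eq_integral_sub hFm hS fun x hx z hz => by
      obtain ⟨k, hk⟩ := exists_nat_gt (max ‖x‖ ‖z‖)
      have hxk : x ∈ Metric.ball (0 : E n) (k + 1) := by
        rw [mem_ball_zero_iff]; linarith [le_max_left ‖x‖ ‖z‖]
      have hzk : z ∈ Metric.ball (0 : E n) (k + 1) := by
        rw [mem_ball_zero_iff]; linarith [le_max_right ‖x‖ ‖z‖]
      refine ⟨hx.1.sub hz.1, ?_⟩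
      rw [hasFiniteIntegral_iff_enorm]
      exact (hle k x hxk z hzk).trans_lt (ENNReal.add_lt_top.2
        ⟨ENNReal.add_lt_top.2 ⟨hx.2 k hxk, hz.2 k hzk⟩, (hM k).lt_top⟩)
    obtain ⟨hloc, hosc⟩ := main g hg (hgF.mono fun x hx => hx.mono fun z hz => by
      rw [hz.2]; exact enorm_integral_le_lintegral_enorm _)
    exact ⟨g, hloc, hgF, hosc⟩
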